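/- Let $d\ge 2$, $q=e^{2\pi i/d}$, $X|i\rangle=|i+1\rangle$ and $Z|i\rangle=q^{i}|i\rangle$ on $\mathbb{C}\mathbb{Z}_d$. \textbf{Patches.} A patch is a rectangular piece of the square lattice, edges pointing right and up, with one qudit $\mathbb{C}\mathbb{Z}_d$ on each edge, rough (dangling vertical edges) at the bottom and top and smooth at the left and right. Its stabilisers are: at each vertex $v$ other than a free end of a dangling edge, $A_v$, the product of $X$ on the edges leaving $v$ and $X^\dagger$ on those pointing towards $v$, with outcomes $j\in\mathbb{Z}_d$ and projectors $P_v(j)=\frac1d\sum_k q^{jk}A_v^k$; at each face $p$ (a square between two adjacent columns; the top and bottom ones have three edges, or two if there is only one row of vertical edges), the signed sum, clockwise around $p$, of the edge labels, with outcomes $j\in\mathbb{Z}_d$ and projectors $P_p(j)$ onto the labellings with sum $j$. The logical space $\mathcal{H}_{vac}$ is the common range of all $P_v(0)$, $P_p(0)$. $X_L^i$ is the product of the $X^i$ on the vertical edges at one height (string from left to right), $Z_L^i$ the product of the $(Z^{i})^\dagger$ on the vertical edges of one column (string from top to bottom, against the arrows). Put $|0\rangle_L=\prod_vP_v(0)\bigotimes_E|0\rangle$,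 $|i\rangle_L=X_L^i|0\rangle_L$, $|\delta_0\rangle_L=\sum_k|k\rangle_L$, $|\delta_i\rangle_L=Z_L^i|\delta_0\rangle_L$. Then $\{|i\rangle_L\}_{i\in\mathbb{Z}_d}$ and $\{|\delta_i\rangle_L\}_{i\in\mathbb{Z}_d}$ are bases of $\mathcal{H}_{vac}$. All statements here and below hold for every choice of heights and columns of the strings. \textbf{Smooth merge.} Place two patches of the same height side by side (first patch left, second right), join them by one new horizontal edge in each row of vertices, each initialised in $\sum_i|i\rangle$, and measure all stabilisers of the merged patch. For an initial state $\Psi\in(\mathcal{H}_{vac})_1\otimes(\mathcal{H}_{vac})_2$ only the new faces can have nontrivial outcomes. If these are $s=(s_k)_k$, put $n=-\sum_k s_k\in\mathbb{Z}_d$. The outcomes realise a measurement of $Z_L\otimes Z_L^\dagger$ with result $q^n$: the total probability of the $s$ with given $n$ is the probability of the result $q^n$ in $\Psi$, and the state after the outcome $s$ is the one obtained after first projecting $\Psi$ onto the $q^n$-eigenspace of $Z_L\otimes Z_L^\dagger$. For each $s$ there is a product of powers of $X$ that acts trivially on the second patch (Pauli frame of the second patch) and undoes all outcomes. For each such correction,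 initialising, measuring with outcome $s$ and correcting maps $(\mathcal{H}_{vac})_1\otimes(\mathcal{H}_{vac})_2$ into the logical space of the merged patch by the Kraus operator \[|\delta_i\rangle_L\otimes|\delta_j\rangle_L\mapsto q^{in}|\delta_{i+j}\rangle_L,\qquad\text{equivalently}\qquad |i\rangle_L\otimes|j\rangle_L\mapsto\delta_{i+n,j}|i+n\rangle_L .\] \textbf{Rough merge.} Place two patches of the same width on top of each other (first patch above, second below) so that the free ends of the facing dangling edges form a new row of vertices, join neighbours in this row by new horizontal edges, each initialised in $|0\rangle$, and measure all stabilisers of the merged patch. Only the new vertices can have nontrivial outcomes $s$; with $n=-\sum_ks_k$ these realise, in the same sense, a measurement of $X_L\otimes X_L^\dagger$ with result $q^n$. For each $s$ there is a product of powers of $Z$ that acts trivially on the second patch and undoes all outcomes, and with each such correction the merge maps $(\mathcal{H}_{vac})_1\otimes(\mathcal{H}_{vac})_2$ into the logical space of the merged patch by the Kraus operator \[|i\rangle_L\otimes|j\rangle_L\mapsto q^{in}|i+j\rangle_L .\] \textbf{The case $n=0$.} Then the smooth merge is the multiplication of the group algebra $\mathbb{C}\mathbb{Z}_d$ in the basis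 $\{|\delta_i\rangle_L\}$, and that of the function algebra $\mathbb{C}(\mathbb{Z}_d)$ (with $\delta_i$ corresponding to $|i\rangle_L$) in the basis $\{|i\rangle_L\}$; the rough merge is the multiplication of $\mathbb{C}\mathbb{Z}_d$ in the basis $\{|i\rangle_L\}$, and that of $\mathbb{C}(\mathbb{Z}_d)$ with $\delta_i$ corresponding to $\frac1d|\delta_i\rangle_L$. -/

import Mathlib

open scoped TensorProduct

namespace LatticeSurgery

noncomputable section

/-! ### The lattice of a patch -/

/-- The edges of the patch with `w + 1` columns and `r` rows of vertices: `inl (x, y)` is the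
horizontal edge from column `x` to column `x + 1` in row `y`, pointing right, and `inr (x, y)` is
the `y`-th vertical edge from below in column `x`, pointing up. The vertical edges `inr (x, 0)` and
`inr (x, r)` dangle (rough boundaries at the bottom and at the top); the left and the right
boundary are smooth. -/
abbrev Edge (w r : ℕ) : Type := (Fin w × Fin r) ⊕ (Fin (w + 1) × Fin (r + 1))

/-- The vertices of the patch that carry a stabiliser, that is all except the free ends of the
dangling edges. -/
abbrev Vertex (w r : ℕ) : Type := Fin (w + 1) × Fin r

/-- The faces of the patch that carry a stabiliser, that is the unit squares between two adjacent
columns; those in the bottom and in the top row lack their bottom, respectively top, edge. -/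
abbrev Face (w r : ℕ) : Type := Fin w × Fin (r + 1)

/-- The initial point of an edge in the lattice `ℤ × ℤ`. -/
def tail {w r : ℕ} : Edge w r → ℤ × ℤ
  | .inl (x, y) => ((x : ℕ), (y : ℕ) + 1)
  | .inr (x, y) => ((x : ℕ), (y : ℕ))

/-- The final point of an edge. -/
def head {w r : ℕ} : Edge w r → ℤ × ℤ
  | .inl (x, y) => ((x : ℕ) + 1, (y : ℕ) + 1)
  | .inr (x, y) => ((x : ℕ), (y : ℕ) + 1)

/-- The position of a vertex in the lattice `ℤ × ℤ`. -/
def vertexPos {w r : ℕ} (v : Vertex w r) : ℤ × ℤ := ((v.1 : ℕ), (v.2 : ℕ) + 1)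

/-- The lower left corner of a face. -/
def facePos {w r : ℕ} (p : Face w r) : ℤ × ℤ := ((p.1 : ℕ), (p.2 : ℕ))

/-- The lower left corner of the unit square to the right of an edge; the edge runs clockwise
around this square. -/
def rightCell {w r : ℕ} : Edge w r → ℤ × ℤ
  | .inl (x, y) => ((x : ℕ), (y : ℕ))
  | .inr (x, y) => ((x : ℕ), (y : ℕ))

/-- The lower left corner of the unit square to the left of an edge; the edge runs anticlockwise
around this square. -/
def leftCell {w r : ℕ} : Edge w r → ℤ × ℤ
  | .inl (x, y) => ((x : ℕ), (y : ℕ) + 1)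
  | .inr (x, y) => ((x : ℕ) - 1, (y : ℕ))

variable (d : ℕ) [NeZero d]

/-- `1` on edges that leave the vertex, `-1` on edges that point towards it, and `0` elsewhere. -/
def vertexWeight {w r : ℕ} (v : Vertex w r) (e : Edge w r) : ZMod d :=
  (if tail e = vertexPos v then 1 else 0) - (if head e = vertexPos v then 1 else 0)

/-- `1` on edges that run clockwise around the face, `-1` on edges that run anticlockwise around
it, and `0` elsewhere. -/
def faceWeight {w r : ℕ} (p : Face w r) (e : Edge w r) : ZMod d :=
  (if rightCell e = facePos p then 1 else 0) - (if leftCell e = facePos p then 1 else 0)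

/-! ### Hilbert space, stabilisers and vacuum -/

/-- The tensor product of one copy of `ℂ ℤ_d` for each edge: the Hilbert space with orthonormal
basis `|c⟩`, for `c : Edge w r → ZMod d`. -/
abbrev Hilb (w r : ℕ) : Type := EuclideanSpace ℂ (Edge w r → ZMod d)

/-- `q ^ (j * k)` with `q = exp (2 π i / d)`. -/
def qpow (j k : ZMod d) : ℂ := ZMod.stdAddChar (j * k)

variable {d}

/-- The operator `⨂_e X ^ t e`, that is `|c⟩ ↦ |c + t⟩`. -/
def xOp {w r : ℕ} (t : Edge w r → ZMod d) : Module.End ℂ (Hilb d w r) where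
  toFun ψ := WithLp.toLp 2 fun c => ψ (c - t)
  map_add' ψ φ := by ext c; simp
  map_smul' a ψ := by ext c; simp

/-- The diagonal operator `|c⟩ ↦ f c • |c⟩`. -/
def diagOp {w r : ℕ} (f : (Edge w r → ZMod d) → ℂ) : Module.End ℂ (Hilb d w r) where
  toFun ψ := WithLp.toLp 2 fun c => f c * ψ c
  map_add' ψ φ := by ext c; simp [mul_add]
  map_smul' a ψ := by ext c; simp [mul_left_comm]

/-- The operator `⨂_e Z ^ t e`, where `Z ^ m |i⟩ = q ^ (m i) |i⟩`. -/
def zOp {w r : ℕ} (t : Edge w r → ZMod d) : Module.End ℂ (Hilb d w r) :=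
  diagOp fun c => ∏ e, qpow d (t e) (c e)

/-- The action of `|l⟩ ∈ ℂ ℤ_d` at a vertex. -/
def vertexAct {w r : ℕ} (v : Vertex w r) (l : ZMod d) : Module.End ℂ (Hilb d w r) :=
  xOp fun e => l * vertexWeight d v e

/-- The projector `P_v(j) = (1/d) ∑_k q ^ (j k) |k⟩ ▷_v`, the measurement outcome `j` at the
vertex `v`. -/
def vertexProj {w r : ℕ} (v : Vertex w r) (j : ZMod d) : Module.End ℂ (Hilb d w r) :=
  (1 / (d : ℂ)) • ∑ k : ZMod d, qpow d j k • vertexAct v k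

/-- The signed sum of an edge labelling around a face, clockwise. -/
def flux {w r : ℕ} (p : Face w r) (c : Edge w r → ZMod d) : ZMod d :=
  ∑ e, faceWeight d p e * c e

/-- The projector `P_p(j) = |δ_j⟩ ▷_p`, the measurement outcome `j` at the face `p`. -/
def faceProj {w r : ℕ} (p : Face w r) (j : ZMod d) : Module.End ℂ (Hilb d w r) :=
  diagOp fun c => if flux p c = j then 1 else 0

theorem xOp_commute {w r : ℕ} (s t : Edge w r → ZMod d) : Commute (xOp s) (xOp t) := by
  ext ψ c
  change ψ (c - s - t) = ψ (c - t - s)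
  rw [sub_right_comm]

theorem vertexProj_commute {w r : ℕ} (v v' : Vertex w r) (j j' : ZMod d) :
    Commute (vertexProj v j) (vertexProj v' j') := by
  unfold vertexProj
  refine Commute.smul_left (Commute.smul_right ?_ _) _
  refine Commute.sum_left _ _ _ fun k _ => Commute.sum_right _ _ _ fun k' _ => ?_
  exact Commute.smul_left (Commute.smul_right (xOp_commute _ _) _) _

theorem faceProj_commute {w r : ℕ} (p p' : Face w r) (j j' : ZMod d) :
    Commute (faceProj p j) (faceProj p' j') := by
  ext ψ c
  exact mul_left_comm _ _ _

/-- The operator of a round of measurements of all stabilisers of the patch, with outcomes `a v` at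
the vertices and `b p` at the faces. -/
def syndromeProj {w r : ℕ} (a : Vertex w r → ZMod d) (b : Face w r → ZMod d) :
    Module.End ℂ (Hilb d w r) :=
  (Finset.univ.noncommProd (fun v => vertexProj v (a v))
      fun _ _ _ _ _ => vertexProj_commute _ _ _ _) *
    Finset.univ.noncommProd (fun p => faceProj p (b p))
      fun _ _ _ _ _ => faceProj_commute _ _ _ _

variable (d) in
/-- The vacuum space of the patch, which is its logical space. -/
def vac (w r : ℕ) : Submodule ℂ (Hilb d w r) :=
  (⨅ v : Vertex w r, LinearMap.eqLocus (vertexProj v 0) LinearMap.id) ⊓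
    ⨅ p : Face w r, LinearMap.eqLocus (faceProj p 0) LinearMap.id

/-! ### Logical operators and logical states -/

/-- The string operator `X_L ^ i`: the `X`-type string crosses all vertical edges at height `y`,
from left to right. -/
def xString {w r : ℕ} (y : Fin (r + 1)) (i : ZMod d) : Module.End ℂ (Hilb d w r) :=
  xOp fun
    | .inl _ => 0
    | .inr (_, y') => if y' = y then i else 0

/-- The string operator `Z_L ^ i`: the `Z`-type string runs along the column `x` from top to bottom,
hence against the direction of its edges, each of which receives `(Z ^ i)†`. -/
def zString {w r : ℕ} (x : Fin (w + 1)) (i : ZMod d) : Module.End ℂ (Hilb d w r) :=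
  zOp fun
    | .inl _ => 0
    | .inr (x', _) => if x' = x then -i else 0

variable (d) in
/-- The state `|0⟩_L = ∏_v A(v) ⨂_E |0⟩`. -/
def ketZero (w r : ℕ) : Hilb d w r :=
  (Finset.univ.noncommProd (fun v : Vertex w r => vertexProj v (0 : ZMod d))
    fun _ _ _ _ _ => vertexProj_commute _ _ _ _) (EuclideanSpace.single 0 1)

/-- The state `|i⟩_L = X_L ^ i |0⟩_L`, with the logical operator at height `y`. -/
def ket {w r : ℕ} (y : Fin (r + 1)) (i : ZMod d) : Hilb d w r := xString y i (ketZero d w r)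

/-- The state `|δ_i⟩_L = Z_L ^ i |δ_0⟩_L`, with `|δ_0⟩_L = ∑_k |k⟩_L` and the logical operator in
the column `x`. -/
def deltaKet {w r : ℕ} (x : Fin (w + 1)) (y : Fin (r + 1)) (i : ZMod d) : Hilb d w r :=
  zString x i (∑ k, ket y k)

variable (d) in
/-- The logical space `(H_vac)₁ ⊗ (H_vac)₂` of two disjoint patches, as a subspace of the tensor
product of their Hilbert spaces. -/
def pairVac (w₁ r₁ w₂ r₂ : ℕ) : Submodule ℂ (Hilb d w₁ r₁ ⊗[ℂ] Hilb d w₂ r₂) :=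
  LinearMap.range (TensorProduct.mapIncl (vac d w₁ r₁) (vac d w₂ r₂))

/-! ### Measurements -/

/-- The probability `‖M φ‖² / ‖φ‖²` of the outcome with measurement operator `M` in the state of
the (not necessarily normalised) vector `φ`. -/
def prob {V W : Type*} [NormedAddCommGroup V] [NormedAddCommGroup W] [Module ℂ V] [Module ℂ W]
    (M : V →ₗ[ℂ] W) (φ : V) : ℝ := ‖M φ‖ ^ 2 / ‖φ‖ ^ 2

/-- In a measurement of a unitary operator `U` whose eigenvalues are powers of `q`, the projector
of the outcome `n`: the orthogonal projection onto the eigenspace of `q ^ n`. -/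
def outcomeProj {V : Type*} [NormedAddCommGroup V] [InnerProductSpace ℂ V]
    [FiniteDimensional ℂ V] (U : Module.End ℂ V) (n : ZMod d) : Module.End ℂ V :=
  ((Module.End.eigenspace U (qpow d 1 n)).starProjection : V →L[ℂ] V)

/-! ### Smooth merges

The first patch is on the left, the second on the right. They have `w₁ + 1` and `w₂ + 1` columns
and `r` rows of vertices each. One new horizontal edge in each row joins them to a patch with
`w₁ + 1 + w₂ + 1` columns, which has `r + 1` new faces, in the column of the seam. -/

section Smooth

variable {w₁ w₂ r : ℕ}

/-- The left patch in the merged one. -/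
def leftEdge : Edge w₁ r → Edge (w₁ + 1 + w₂) r
  | .inl (x, y) => .inl (Fin.castAdd w₂ x.castSucc, y)
  | .inr (x, y) => .inr (Fin.castAdd (w₂ + 1) x, y)

/-- The right patch in the merged one. -/
def rightEdge : Edge w₂ r → Edge (w₁ + 1 + w₂) r
  | .inl (x, y) => .inl (Fin.natAdd (w₁ + 1) x, y)
  | .inr (x, y) => .inr (Fin.natAdd (w₁ + 1) x, y)

variable (w₁ w₂) in
/-- The column of the new faces and edges. -/
def smoothSeam : Fin (w₁ + 1 + w₂) := Fin.castAdd w₂ (Fin.last w₁)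

variable (d w₁ w₂ r) in
/-- Initialise each of the intermediate qudits in the state `∑_i |i⟩`. -/
def smoothInit : Hilb d w₁ r ⊗[ℂ] Hilb d w₂ r →ₗ[ℂ] Hilb d (w₁ + 1 + w₂) r :=
  TensorProduct.lift <| LinearMap.mk₂ ℂ
    (fun ψ φ => WithLp.toLp 2 fun c => ψ (c ∘ leftEdge) * φ (c ∘ rightEdge))
    (fun _ _ _ => by ext c; simp [add_mul])
    (fun _ _ _ => by ext c; simp [mul_assoc])
    (fun _ _ _ => by ext c; simp [mul_add])
    (fun _ _ _ => by ext c; simp [mul_left_comm])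

/-- The face outcomes that are `s` on the new faces and trivial on the old ones. -/
def smoothSyndrome (s : Fin (r + 1) → ZMod d) : Face (w₁ + 1 + w₂) r → ZMod d :=
  fun p => if p.1 = smoothSeam w₁ w₂ then s p.2 else 0

/-- `⨂_e X ^ t e` corrects the outcomes `s` in the Pauli frame of the second patch: it acts
trivially on the second patch and undoes all outcomes. -/
def IsSmoothCorrection (s : Fin (r + 1) → ZMod d) (t : Edge (w₁ + 1 + w₂) r → ZMod d) : Prop :=
  (∀ e : Edge w₂ r, t (rightEdge e) = 0) ∧ ∀ p, flux p t = -smoothSyndrome s p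

/-- Initialise the intermediate qudits, measure all stabilisers with outcomes `s` on the new faces,
and apply the correction `⨂_e X ^ t e`. -/
def smoothKraus (s : Fin (r + 1) → ZMod d) (t : Edge (w₁ + 1 + w₂) r → ZMod d) :
    Hilb d w₁ r ⊗[ℂ] Hilb d w₂ r →ₗ[ℂ] Hilb d (w₁ + 1 + w₂) r :=
  xOp t ∘ₗ syndromeProj 0 (smoothSyndrome s) ∘ₗ smoothInit d w₁ w₂ r

end Smooth

/-! ### Rough merges

The first patch is on top, the second below it. They have `r₁` and `r₂` rows and `w + 1` columns of
vertices each. The `w` new horizontal edges between them make the free ends of the dangling edges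
into a new row of `w + 1` vertices; the merged patch has `r₂ + 1 + r₁` rows of vertices. -/

section Rough

variable {w r₁ r₂ : ℕ}

/-- The upper patch in the merged one. -/
def topEdge : Edge w r₁ → Edge w (r₂ + 1 + r₁)
  | .inl (x, y) => .inl (x, Fin.natAdd (r₂ + 1) y)
  | .inr (x, y) => .inr (x, Fin.natAdd (r₂ + 1) y)

/-- The lower patch in the merged one. -/
def bottomEdge : Edge w r₂ → Edge w (r₂ + 1 + r₁)
  | .inl (x, y) => .inl (x, Fin.castAdd r₁ y.castSucc)
  | .inr (x, y) => .inr (x, Fin.castAdd (r₁ + 1) y)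

variable (r₁ r₂) in
/-- The row of the new vertices and edges. -/
def roughSeam : Fin (r₂ + 1 + r₁) := Fin.castAdd r₁ (Fin.last r₂)

variable (d w r₁ r₂) in
/-- Initialise each of the intermediate qudits in the state `|0⟩`. -/
def roughInit : Hilb d w r₁ ⊗[ℂ] Hilb d w r₂ →ₗ[ℂ] Hilb d w (r₂ + 1 + r₁) :=
  TensorProduct.lift <| LinearMap.mk₂ ℂ
    (fun ψ φ => WithLp.toLp 2 fun c =>
      if ∀ x : Fin w, c (.inl (x, roughSeam r₁ r₂)) = 0
        then ψ (c ∘ topEdge) * φ (c ∘ bottomEdge) else 0)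
    (fun _ _ _ => by ext c; by_cases h : ∀ x : Fin w, c (.inl (x, roughSeam r₁ r₂)) = 0 <;>
      simp [h, add_mul])
    (fun _ _ _ => by ext c; by_cases h : ∀ x : Fin w, c (.inl (x, roughSeam r₁ r₂)) = 0 <;>
      simp [h, mul_assoc])
    (fun _ _ _ => by ext c; by_cases h : ∀ x : Fin w, c (.inl (x, roughSeam r₁ r₂)) = 0 <;>
      simp [h, mul_add])
    (fun _ _ _ => by ext c; by_cases h : ∀ x : Fin w, c (.inl (x, roughSeam r₁ r₂)) = 0 <;>
      simp [h, mul_left_comm])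

/-- The vertex outcomes that are `s` on the new vertices and trivial on the old ones. -/
def roughSyndrome (s : Fin (w + 1) → ZMod d) : Vertex w (r₂ + 1 + r₁) → ZMod d :=
  fun v => if v.2 = roughSeam r₁ r₂ then s v.1 else 0

/-- `⨂_e Z ^ t e` corrects the outcomes `s` in the Pauli frame of the second patch: it acts
trivially on the second patch and undoes all outcomes. -/
def IsRoughCorrection (s : Fin (w + 1) → ZMod d) (t : Edge w (r₂ + 1 + r₁) → ZMod d) : Prop :=
  (∀ e : Edge w r₂, t (bottomEdge e) = 0) ∧
    ∀ v, ∑ e, vertexWeight d v e * t e = -roughSyndrome s v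

/-- Initialise the intermediate qudits, measure all stabilisers with outcomes `s` on the new
vertices, and apply the correction `⨂_e Z ^ t e`. -/
def roughKraus (s : Fin (w + 1) → ZMod d) (t : Edge w (r₂ + 1 + r₁) → ZMod d) :
    Hilb d w r₁ ⊗[ℂ] Hilb d w r₂ →ₗ[ℂ] Hilb d w (r₂ + 1 + r₁) :=
  zOp t ∘ₗ syndromeProj (roughSyndrome s) 0 ∘ₗ roughInit d w r₁ r₂

end Rough

/-! ### The two algebras on a logical space -/

/-- The linear map from `ℂ ℤ_d` with `|i⟩ ↦ u i`. -/
def groupEncode {V : Type*} [AddCommGroup V] [Module ℂ V] (u : ZMod d → V)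
    (a : AddMonoidAlgebra ℂ (ZMod d)) : V := ∑ i, a.coeff i • u i

/-- The linear map from the algebra `ℂ(ℤ_d)` of functions on `ℤ_d` with `δ_i ↦ u i`. -/
def functionEncode {V : Type*} [AddCommGroup V] [Module ℂ V] (u : ZMod d → V)
    (f : ZMod d → ℂ) : V := ∑ i, f i • u i

end

end LatticeSurgery

open LatticeSurgery

/-!
Work in the basis of edge labellings `c`. The products of the operators `A_v ^ k v` are the shifts
by `coboundary k`, and a labelling is a coboundary exactly if it is flat (no circulation around a
face) and one, hence each, of its columns sums to zero (`exists_coboundary_iff`). Therefore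
`|i⟩_L` is the uniform superposition of the flat labellings with column sum `i` (`ket_apply`),
which no longer depends on the height of the string. The vacuum consists of the states on flat
labellings that are invariant under coboundaries (`mem_vac_iff`), so that these states span it,
and the `|δ_i⟩_L` are their Fourier transforms. A round of measurements projects onto a prescribed
flux and averages over all coboundaries against a character (`syndromeProj_apply`).

In a smooth merge the initial state is already invariant under all vertex operators, and the
measurement only selects the labellings with flux `s` in the seam. The sum of this flux is the
difference `i - j` of the column sums of the two patches, and a correction makes the labelling
flat without touching the right patch, whose column sum `j = i + n` is the result
(`smoothKraus_ket`).

In a rough merge the initial state already lives on flat labellings, and the measurement averages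
over the labels `k` on the new vertices against a character. Given a flat labelling of the merged
patch, exactly one `k` contributes: the sums of the labels above the new vertices, minus `i`
(`roughInit_ket_sub_coboundary`). This leaves a phase. A correction, which is trivial on the lower
patch, pairs with flat labellings through the same sums (`IsRoughCorrection.sum_mul`), and cancels
the phase up to `q ^ (i n)` (`roughKraus_ket`).

As the outcomes form a complete family of orthogonal projections and the initialisation is a
multiple of an isometry, it is enough for the measurement statements that the outcome `s`
annihilates the eigenvectors of the logical operator whose eigenvalue is not `q ^ n`
(`measurement_realises`). These eigenvectors are the `|i⟩_L ⊗ |j⟩_L` for smooth and the `|δ_i⟩_L ⊗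
|δ_j⟩_L` for rough merges.
-/

set_option linter.unusedSectionVars false

namespace LatticeSurgery

noncomputable section

variable {d : ℕ} [NeZero d] {w r : ℕ}

/-! ### Chains and cochains of a patch -/

/-- The labels `f` of the rows of a column, extended by zero: row `y` is at height `y + 1`, and the
heights `0` and `r + 1`, or more, are outside of the patch. -/
def rowLabel (f : Fin r → ZMod d) (n : ℕ) : ZMod d :=
  ∑ y : Fin r, if (y : ℕ) + 1 = n then f y else 0

theorem rowLabel_zero (f : Fin r → ZMod d) : rowLabel f 0 = 0 := by simp [rowLabel]

theorem rowLabel_succ (f : Fin r → ZMod d) (y : Fin r) : rowLabel f (y + 1) = f y := by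
  simp [rowLabel, Fin.val_inj]

theorem rowLabel_of_lt (f : Fin r → ZMod d) {n : ℕ} (h : r < n) : rowLabel f n = 0 := by
  refine Finset.sum_eq_zero fun y _ => if_neg ?_
  have := y.2
  omega

/-- The edge labelling `∑_v k v * (edges leaving v - edges pointing towards v)`: the product of the
operators `A_v ^ k v` is `⨂_e X ^ coboundary k e`. -/
def coboundary (k : Vertex w r → ZMod d) : Edge w r → ZMod d :=
  fun e => ∑ v, k v * vertexWeight d v e

theorem coboundary_inl (k : Vertex w r → ZMod d) (x : Fin w) (y : Fin r) :
    coboundary k (.inl (x, y)) = k (x.castSucc, y) - k (x.succ, y) := by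
  have h1 : ∀ v : Vertex w r,
      (tail (.inl (x, y) : Edge w r) = vertexPos v) ↔ (x.castSucc, y) = v := by
    rintro ⟨a, b⟩
    simp [tail, vertexPos, Fin.ext_iff]
  have h2 : ∀ v : Vertex w r,
      (head (.inl (x, y) : Edge w r) = vertexPos v) ↔ (x.succ, y) = v := by
    rintro ⟨a, b⟩
    simp only [head, vertexPos, Fin.ext_iff, Prod.mk.injEq, Fin.val_succ]
    omega
  simp [coboundary, vertexWeight, h1, h2, mul_sub]

theorem coboundary_inr (k : Vertex w r → ZMod d) (x : Fin (w + 1)) (y : Fin (r + 1)) :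
    coboundary k (.inr (x, y)) =
      rowLabel (fun y' => k (x, y')) y - rowLabel (fun y' => k (x, y')) (y + 1) := by
  have h1 : ∀ (a : Fin (w + 1)) (b : Fin r),
      (tail (.inr (x, y) : Edge w r) = vertexPos (a, b)) ↔ x = a ∧ (b : ℕ) + 1 = y := by
    intro a b
    simp only [tail, vertexPos, Fin.ext_iff, Prod.mk.injEq]
    omega
  have h2 : ∀ (a : Fin (w + 1)) (b : Fin r),
      (head (.inr (x, y) : Edge w r) = vertexPos (a, b)) ↔ x = a ∧ (b : ℕ) + 1 = y + 1 := by
    intro a b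
    simp only [head, vertexPos, Fin.ext_iff, Prod.mk.injEq]
    omega
  simp [coboundary, vertexWeight, h1, h2, mul_sub, Fintype.sum_prod_type, rowLabel, ite_and,
    Finset.sum_ite_irrel]

theorem flux_eq (p : Face w r) (c : Edge w r → ZMod d) :
    flux p c = rowLabel (fun y => c (.inl (p.1, y))) (p.2 + 1) -
      rowLabel (fun y => c (.inl (p.1, y))) p.2 +
        c (.inr (p.1.castSucc, p.2)) - c (.inr (p.1.succ, p.2)) := by
  obtain ⟨x, y⟩ := p
  have h1 : ∀ a b, (rightCell (.inl (a, b) : Edge w r) = facePos (x, y)) ↔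
      x = a ∧ (b : ℕ) + 1 = y + 1 := by
    intro a b
    simp only [rightCell, facePos, Fin.ext_iff, Prod.mk.injEq]
    omega
  have h2 : ∀ a b, (leftCell (.inl (a, b) : Edge w r) = facePos (x, y)) ↔
      x = a ∧ (b : ℕ) + 1 = y := by
    intro a b
    simp only [leftCell, facePos, Fin.ext_iff, Prod.mk.injEq]
    omega
  have h3 : ∀ a b, (rightCell (.inr (a, b) : Edge w r) = facePos (x, y)) ↔
      x.castSucc = a ∧ y = b := by
    intro a b
    simp only [rightCell, facePos, Fin.ext_iff, Prod.mk.injEq, Fin.val_castSucc]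
    omega
  have h4 : ∀ a b, (leftCell (.inr (a, b) : Edge w r) = facePos (x, y)) ↔
      x.succ = a ∧ y = b := by
    intro a b
    simp only [leftCell, facePos, Fin.ext_iff, Prod.mk.injEq, Fin.val_succ]
    omega
  simp [flux, faceWeight, h1, h2, h3, h4, sub_mul, Fintype.sum_prod_type, rowLabel, ite_and,
    Finset.sum_ite_irrel]
  ring

/-- The sum of the labels of the vertical edges below height `n`. -/
def colSumBelow (x : Fin (w + 1)) (n : ℕ) (c : Edge w r → ZMod d) : ZMod d :=
  ∑ y : Fin (r + 1), if (y : ℕ) < n then c (.inr (x, y)) else 0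

/-- The sum of the labels of the vertical edges in a column. -/
def colSum (x : Fin (w + 1)) (c : Edge w r → ZMod d) : ZMod d := ∑ y, c (.inr (x, y))

theorem colSumBelow_zero (x : Fin (w + 1)) (c : Edge w r → ZMod d) : colSumBelow x 0 c = 0 := by
  simp [colSumBelow]

theorem colSumBelow_succ (x : Fin (w + 1)) (y : Fin (r + 1)) (c : Edge w r → ZMod d) :
    colSumBelow x (y + 1) c = colSumBelow x y c + c (.inr (x, y)) := by
  have : c (.inr (x, y)) = ∑ y' : Fin (r + 1), if y' = y then c (.inr (x, y')) else 0 := by simp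
  rw [this, colSumBelow, colSumBelow, ← Finset.sum_add_distrib]
  refine Finset.sum_congr rfl fun y' _ => ?_
  rcases lt_trichotomy y' y with h | rfl | h
  · have : (y' : ℕ) < y := h
    simp [h.ne, this, Nat.lt_succ_of_lt this]
  · simp
  · have : (y : ℕ) < y' := h
    simp [h.ne', this.not_gt, show ¬ (y' : ℕ) < y + 1 by omega]

theorem colSumBelow_of_lt (x : Fin (w + 1)) {n : ℕ} (h : r < n) (c : Edge w r → ZMod d) :
    colSumBelow x n c = colSum x c :=
  Finset.sum_congr rfl fun y _ => if_pos (by have := y.2; omega)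

theorem colSum_sub (x : Fin (w + 1)) (c c' : Edge w r → ZMod d) :
    colSum x (c - c') = colSum x c - colSum x c' := by
  simp [colSum]

theorem flux_sub (p : Face w r) (c c' : Edge w r → ZMod d) :
    flux p (c - c') = flux p c - flux p c' := by
  simp [flux, mul_sub]

/-- The sum of the clockwise circulations around the faces of a column of faces below height
`n`: the inner horizontal edges cancel. -/
theorem rowLabel_eq (c : Edge w r → ZMod d) (x : Fin w) {n : ℕ} (hn : n ≤ r + 1) :
    rowLabel (fun y => c (.inl (x, y))) n =
      (∑ y : Fin (r + 1), if (y : ℕ) < n then flux (x, y) c else 0) +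
        colSumBelow x.succ n c - colSumBelow x.castSucc n c := by
  induction n with
  | zero => simp [rowLabel_zero, colSumBelow_zero]
  | succ n ih =>
    have h := flux_eq (x, ⟨n, hn⟩) c
    have hs : (∑ y : Fin (r + 1), if (y : ℕ) < n + 1 then flux (x, y) c else 0) =
        (∑ y : Fin (r + 1), if (y : ℕ) < n then flux (x, y) c else 0) + flux (x, ⟨n, hn⟩) c := by
      have h0 := colSumBelow_succ (0 : Fin (0 + 1)) ⟨n, hn⟩
        (Sum.elim (fun _ => 0) fun e => flux (x, e.2) c)
      simpa [colSumBelow] using h0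
    have h1 := colSumBelow_succ x.succ ⟨n, hn⟩ c
    have h2 := colSumBelow_succ x.castSucc ⟨n, hn⟩ c
    simp only at h h1 h2
    rw [hs, h1, h2, h]
    linear_combination ih (by omega)

theorem sum_flux (c : Edge w r → ZMod d) (x : Fin w) :
    ∑ y, flux (x, y) c = colSum x.castSucc c - colSum x.succ c := by
  have h := rowLabel_eq c x le_rfl
  rw [rowLabel_of_lt _ (Nat.lt_succ_self r), colSumBelow_of_lt _ (Nat.lt_succ_self r),
    colSumBelow_of_lt _ (Nat.lt_succ_self r)] at h
  have : (∑ y : Fin (r + 1), if (y : ℕ) < r + 1 then flux (x, y) c else 0) = ∑ y, flux (x, y) c :=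
    Finset.sum_congr rfl fun y _ => if_pos y.2
  rw [this] at h
  linear_combination -h

theorem colSum_zero_sub_colSum_last (c : Edge w r → ZMod d) :
    colSum 0 c - colSum (Fin.last w) c = ∑ x, ∑ y, flux (x, y) c := by
  simp_rw [sum_flux]
  rw [Finset.sum_sub_distrib, sub_eq_sub_iff_add_eq_add, ← Fin.sum_univ_succ fun x => colSum x c,
    Fin.sum_univ_castSucc fun x => colSum x c]

theorem flux_coboundary (p : Face w r) (k : Vertex w r → ZMod d) : flux p (coboundary k) = 0 := by
  obtain ⟨x, y⟩ := p
  have h (n : ℕ) : rowLabel (fun y => coboundary k (.inl (x, y))) n =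
      rowLabel (fun y => k (x.castSucc, y)) n - rowLabel (fun y => k (x.succ, y)) n := by
    simp only [rowLabel, coboundary_inl, ← Finset.sum_sub_distrib]
    refine Finset.sum_congr rfl fun y _ => ?_
    split_ifs <;> simp
  rw [flux_eq, h, h, coboundary_inr, coboundary_inr]
  ring

theorem colSumBelow_coboundary (x : Fin (w + 1)) {n : ℕ} (hn : n ≤ r + 1)
    (k : Vertex w r → ZMod d) :
    colSumBelow x n (coboundary k) = -rowLabel (fun y => k (x, y)) n := by
  induction n with
  | zero => simp [rowLabel_zero, colSumBelow_zero]
  | succ n ih =>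
    have h1 := colSumBelow_succ x ⟨n, hn⟩ (coboundary k)
    simp only at h1
    rw [h1, ih (by omega), coboundary_inr]
    ring

theorem colSum_coboundary (x : Fin (w + 1)) (k : Vertex w r → ZMod d) :
    colSum x (coboundary k) = 0 := by
  rw [← colSumBelow_of_lt x (Nat.lt_succ_self r), colSumBelow_coboundary x le_rfl,
    rowLabel_of_lt _ (Nat.lt_succ_self r), neg_zero]

theorem coboundary_injective :
    Function.Injective (coboundary : (Vertex w r → ZMod d) → Edge w r → ZMod d) := by
  intro k k' h
  ext ⟨x, y⟩
  have h1 := colSumBelow_coboundary x (n := y + 1) (by omega) k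
  rw [h, colSumBelow_coboundary x (by omega), rowLabel_succ, rowLabel_succ] at h1
  exact (neg_inj.mp h1).symm

theorem coboundary_zero : coboundary (0 : Vertex w r → ZMod d) = 0 := by
  ext e
  simp [coboundary]

theorem coboundary_add (k k' : Vertex w r → ZMod d) :
    coboundary (k + k') = coboundary k + coboundary k' := by
  ext e
  simp [coboundary, add_mul, Finset.sum_add_distrib]

theorem coboundary_neg (k : Vertex w r → ZMod d) : coboundary (-k) = -coboundary k := by
  ext e
  simp [coboundary]

theorem coboundary_single (v : Vertex w r) (l : ZMod d) :
    coboundary (Pi.single v l) = fun e => l * vertexWeight d v e := by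
  ext e
  simp [coboundary, Pi.single_apply]

/-- An edge labelling is flat if it has trivial circulation around each face. -/
def IsFlat (c : Edge w r → ZMod d) : Prop := ∀ p, flux p c = 0

theorem IsFlat.colSum_eq {c : Edge w r → ZMod d} (hc : IsFlat c) (x x' : Fin (w + 1)) :
    colSum x c = colSum x' c := by
  have h (x : Fin (w + 1)) : colSum x c = colSum 0 c := by
    induction x using Fin.induction with
    | zero => rfl
    | succ x ih =>
      have := sum_flux c x
      rw [Finset.sum_eq_zero fun y _ => hc _] at this
      rw [← ih]
      exact (sub_eq_zero.mp this.symm).symm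
  rw [h x, h x']

/-- The first cohomology of the patch relative to its rough boundaries is `ZMod d`, detected by the
sum of the labels of any column. -/
theorem exists_coboundary_iff (c : Edge w r → ZMod d) (x : Fin (w + 1)) :
    (∃ k, coboundary k = c) ↔ IsFlat c ∧ colSum x c = 0 := by
  refine ⟨?_, fun ⟨hc, hx⟩ => ?_⟩
  · rintro ⟨k, rfl⟩
    exact ⟨fun p => flux_coboundary p k, colSum_coboundary x k⟩
  have h0 (x' : Fin (w + 1)) : colSum x' c = 0 := (hc.colSum_eq x' x).trans hx
  have hrow (x' : Fin (w + 1)) {n : ℕ} (hn : n ≤ r + 1) :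
      rowLabel (fun y : Fin r => -colSumBelow x' (y + 1) c) n = -colSumBelow x' n c := by
    rcases n with _ | n
    · simp [rowLabel_zero, colSumBelow_zero]
    · rcases Nat.lt_or_ge n r with h | h
      · exact rowLabel_succ (fun y : Fin r => -colSumBelow x' (y + 1) c) ⟨n, h⟩
      · rw [rowLabel_of_lt _ (by omega), colSumBelow_of_lt _ (by omega), h0, neg_zero]
  refine ⟨fun v => -colSumBelow v.1 (v.2 + 1) c, ?_⟩
  ext (⟨x', y⟩ | ⟨x', y⟩)
  · have h := rowLabel_eq c x' (n := y + 1) (by omega)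
    rw [rowLabel_succ, Finset.sum_eq_zero fun y _ => by simp [hc (x', y)]] at h
    rw [coboundary_inl, h]
    ring
  · rw [coboundary_inr, hrow x' (by omega), hrow x' (by omega), colSumBelow_succ]
    ring

/-- The labelling `i` on the vertical edges at height `y`, of the string operator `X_L ^ i`. -/
def rowString (y : Fin (r + 1)) (i : ZMod d) : Edge w r → ZMod d
  | .inl _ => 0
  | .inr (_, y') => if y' = y then i else 0

theorem flux_rowString (p : Face w r) (y : Fin (r + 1)) (i : ZMod d) :
    flux p (rowString y i) = 0 := by
  simp [flux_eq, rowString, rowLabel]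

theorem colSum_rowString (x : Fin (w + 1)) (y : Fin (r + 1)) (i : ZMod d) :
    colSum x (rowString y i : Edge w r → ZMod d) = i := by
  simp [colSum, rowString]

/-! ### Characters of `ℤ_d` -/

theorem qpow_add_left (j j' k : ZMod d) : qpow d (j + j') k = qpow d j k * qpow d j' k := by
  simp [qpow, add_mul, AddChar.map_add_eq_mul]

theorem qpow_add_right (j k k' : ZMod d) : qpow d j (k + k') = qpow d j k * qpow d j k' := by
  simp [qpow, mul_add, AddChar.map_add_eq_mul]

theorem qpow_zero_left (k : ZMod d) : qpow d 0 k = 1 := by simp [qpow]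

theorem qpow_zero_right (k : ZMod d) : qpow d k 0 = 1 := by simp [qpow]

theorem qpow_neg_left (j k : ZMod d) : qpow d (-j) k = qpow d j (-k) := by simp [qpow]

theorem qpow_mul_neg (j k : ZMod d) : qpow d j k * qpow d j (-k) = 1 := by
  rw [← qpow_add_right, add_neg_cancel, qpow_zero_right]

theorem conj_qpow (j k : ZMod d) : starRingEnd ℂ (qpow d j k) = qpow d j (-k) := by
  rw [qpow, qpow, mul_neg, AddChar.map_neg_eq_conj]

theorem qpow_sum {ι : Type*} (s : Finset ι) (j : ZMod d) (f : ι → ZMod d) :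
    qpow d j (∑ i ∈ s, f i) = ∏ i ∈ s, qpow d j (f i) := by
  classical
  induction s using Finset.induction_on with
  | empty => simp [qpow]
  | insert i s hi ih => rw [Finset.sum_insert hi, Finset.prod_insert hi, qpow_add_right, ih]

theorem qpow_one_injective : Function.Injective (qpow d 1) := by
  intro j k h
  simpa [qpow] using ZMod.injective_stdAddChar h

theorem sum_qpow (k : ZMod d) : ∑ j, qpow d j k = if k = 0 then (d : ℂ) else 0 := by
  have h := AddChar.sum_mulShift k (ZMod.isPrimitive_stdAddChar d)
  simp only [ZMod.card] at h
  rw [show ∑ j, qpow d j k = ∑ j, ZMod.stdAddChar (j * k) from rfl, h]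
  split_ifs <;> simp

theorem natCast_ne_zero : (d : ℂ) ≠ 0 := Nat.cast_ne_zero.mpr (NeZero.ne d)

/-- The pairing `q ^ (∑_v a v * k v)`. -/
def pairing {ι : Type*} [Fintype ι] (a k : ι → ZMod d) : ℂ := qpow d 1 (∑ v, a v * k v)

section pairing

variable {ι : Type*} [Fintype ι]

theorem pairing_eq_prod (a k : ι → ZMod d) : pairing a k = ∏ v, qpow d (a v) (k v) := by
  rw [pairing, qpow_sum]
  simp [qpow]

theorem pairing_add_right (a k k' : ι → ZMod d) :
    pairing a (k + k') = pairing a k * pairing a k' := by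
  simp [pairing, mul_add, Finset.sum_add_distrib, qpow_add_right]

theorem pairing_neg_right (a k : ι → ZMod d) :
    pairing a (-k) = starRingEnd ℂ (pairing a k) := by
  simp [pairing, conj_qpow]

theorem pairing_zero_left (k : ι → ZMod d) : pairing 0 k = 1 := by
  simp [pairing, qpow_zero_right]

theorem pairing_mul_neg (a k : ι → ZMod d) : pairing a k * pairing a (-k) = 1 := by
  rw [← pairing_add_right, add_neg_cancel]
  simp [pairing, qpow_zero_right]

theorem sum_pairing_left [DecidableEq ι] (k : ι → ZMod d) :
    ∑ a, pairing a k = if k = 0 then (d : ℂ) ^ Fintype.card ι else 0 := by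
  simp_rw [pairing_eq_prod]
  have h := Finset.prod_univ_sum (fun _ : ι => (Finset.univ : Finset (ZMod d)))
    fun v j => qpow d j (k v)
  rw [Fintype.piFinset_univ] at h
  rw [← h]
  simp_rw [sum_qpow]
  split_ifs with hk
  · simp [hk]
  · obtain ⟨v, hv⟩ := Function.ne_iff.mp hk
    exact Finset.prod_eq_zero (Finset.mem_univ v) (if_neg hv)

end pairing

/-! ### Rounds of measurements -/

theorem xOp_add (s t : Edge w r → ZMod d) : xOp (s + t) = xOp s * xOp t := by
  ext ψ c
  change ψ (c - (s + t)) = ψ (c - s - t)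
  rw [sub_sub]

theorem xOp_zero : xOp (0 : Edge w r → ZMod d) = 1 := by
  ext ψ c
  change ψ (c - 0) = ψ c
  rw [sub_zero]

theorem xOp_apply (t : Edge w r → ZMod d) (ψ : Hilb d w r) (c : Edge w r → ZMod d) :
    xOp t ψ c = ψ (c - t) := rfl

theorem diagOp_apply (f : (Edge w r → ZMod d) → ℂ) (ψ : Hilb d w r) (c : Edge w r → ZMod d) :
    diagOp f ψ c = f c * ψ c := rfl

theorem zOp_apply (t : Edge w r → ZMod d) (ψ : Hilb d w r) (c : Edge w r → ZMod d) :
    zOp t ψ c = pairing t c * ψ c := by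
  rw [pairing_eq_prod]
  rfl

/-- The product of the vertex projectors with outcomes `a`. -/
def vertexMeas (a : Vertex w r → ZMod d) : Module.End ℂ (Hilb d w r) :=
  Finset.univ.noncommProd (fun v => vertexProj v (a v))
    fun _ _ _ _ _ => vertexProj_commute _ _ _ _

/-- The product of the face projectors with outcomes `b`. -/
def faceMeas (b : Face w r → ZMod d) : Module.End ℂ (Hilb d w r) :=
  Finset.univ.noncommProd (fun p => faceProj p (b p))
    fun _ _ _ _ _ => faceProj_commute _ _ _ _

theorem syndromeProj_eq (a : Vertex w r → ZMod d) (b : Face w r → ZMod d) :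
    syndromeProj a b = vertexMeas a * faceMeas b := rfl

variable (d w r) in
/-- The representation of the group algebra of the edge labellings by the operators `xOp`. -/
def xOpHom : AddMonoidAlgebra ℂ (Edge w r → ZMod d) →ₐ[ℂ] Module.End ℂ (Hilb d w r) :=
  AddMonoidAlgebra.lift ℂ (Module.End ℂ (Hilb d w r)) (Edge w r → ZMod d)
    { toFun := fun t => xOp t.toAdd
      map_one' := xOp_zero
      map_mul' := fun s t => xOp_add s.toAdd t.toAdd }

theorem xOpHom_single (t : Edge w r → ZMod d) (z : ℂ) :
    xOpHom d w r (AddMonoidAlgebra.single t z) = z • xOp t :=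
  AddMonoidAlgebra.lift_single _ _ _

/-- The product of the vertex projectors is a Fourier component of the representation
`k ↦ ⨂_e X ^ coboundary k e`. All factors lie in the commutative algebra generated by the operators
`xOp`, where the product of sums can be expanded. -/
theorem vertexMeas_eq (a : Vertex w r → ZMod d) :
    vertexMeas a =
      ((d : ℂ) ^ ((w + 1) * r))⁻¹ • ∑ k, pairing a k • xOp (coboundary k) := by
  have h1 (v : Vertex w r) : vertexProj v (a v) = xOpHom d w r (∑ j : ZMod d,
      AddMonoidAlgebra.single (coboundary (Pi.single v j)) ((d : ℂ)⁻¹ * qpow d (a v) j)) := by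
    simp [vertexProj, vertexAct, xOpHom_single, coboundary_single, Finset.smul_sum, mul_smul]
  have h2 : vertexMeas a = Finset.univ.noncommProd (fun v => xOpHom d w r (∑ j : ZMod d,
      AddMonoidAlgebra.single (coboundary (Pi.single v j)) ((d : ℂ)⁻¹ * qpow d (a v) j)))
      (fun v _ v' _ _ => (Commute.all _ _).map (xOpHom d w r)) :=
    Finset.noncommProd_congr rfl (fun v _ => h1 v) _
  have h3 (k : Vertex w r → ZMod d) : ∑ v, coboundary (Pi.single v (k v)) = coboundary k := by
    ext e
    simp [coboundary_single, coboundary]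
  rw [h2, ← Finset.map_noncommProd _ _ (fun v _ v' _ _ => Commute.all _ _),
    Finset.noncommProd_eq_prod, Finset.prod_univ_sum, Fintype.piFinset_univ, map_sum,
    Finset.smul_sum]
  refine Finset.sum_congr rfl fun k _ => ?_
  rw [AddMonoidAlgebra.prod_single, xOpHom_single, h3, Finset.prod_mul_distrib, pairing_eq_prod,
    smul_smul]
  simp

theorem faceMeas_eq (b : Face w r → ZMod d) :
    faceMeas b = diagOp fun c => if ∀ p, flux p c = b p then 1 else 0 := by
  let D : ((Edge w r → ZMod d) → ℂ) →* Module.End ℂ (Hilb d w r) :=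
    { toFun := diagOp
      map_one' := by ext ψ c; exact one_mul _
      map_mul' := fun f g => by ext ψ c; exact mul_assoc _ _ _ }
  have h : faceMeas b = D (∏ p, fun c => if flux p c = b p then 1 else 0) := by
    rw [← Finset.noncommProd_eq_prod]
    exact (Finset.map_noncommProd _ _ (fun _ _ _ _ _ => Commute.all _ _) D).symm
  rw [h]
  change diagOp _ = diagOp _
  congr 1
  ext c
  simp only [Finset.prod_apply]
  convert Fintype.prod_boole (p := fun p => flux p c = b p)

theorem vertexMeas_apply (a : Vertex w r → ZMod d) (ψ : Hilb d w r) (c : Edge w r → ZMod d) :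
    vertexMeas a ψ c =
      ((d : ℂ) ^ ((w + 1) * r))⁻¹ * ∑ k, pairing a k * ψ (c - coboundary k) := by
  simp [vertexMeas_eq, xOp_apply]

theorem faceMeas_apply (b : Face w r → ZMod d) (ψ : Hilb d w r) (c : Edge w r → ZMod d) :
    faceMeas b ψ c = if ∀ p, flux p c = b p then ψ c else 0 := by
  rw [faceMeas_eq, diagOp_apply]
  split_ifs <;> simp

theorem vertexMeas_mul_xOp (a k : Vertex w r → ZMod d) :
    vertexMeas a * xOp (coboundary k) = pairing a (-k) • vertexMeas a := by
  rw [vertexMeas_eq, smul_mul_assoc, smul_comm, Finset.sum_mul]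
  congr 1
  rw [Finset.smul_sum]
  rw [← Equiv.sum_comp (Equiv.addRight k)
    fun k' => pairing a (-k) • pairing a k' • xOp (coboundary k')]
  refine Finset.sum_congr rfl fun k' _ => ?_
  rw [Equiv.coe_addRight, pairing_add_right, coboundary_add, xOp_add, smul_smul, smul_mul_assoc,
    mul_left_comm, mul_comm (pairing a (-k)), pairing_mul_neg, mul_one]

theorem vertexMeas_mul_self (a : Vertex w r → ZMod d) :
    vertexMeas a * vertexMeas a = vertexMeas a := by
  nth_rw 2 [vertexMeas_eq]
  rw [mul_smul_comm, Finset.mul_sum]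
  simp_rw [mul_smul_comm, vertexMeas_mul_xOp, smul_smul, pairing_mul_neg, one_smul]
  rw [Finset.sum_const, Finset.card_univ, ← Nat.cast_smul_eq_nsmul ℂ, smul_smul]
  have hc : (Fintype.card (Vertex w r → ZMod d) : ℂ) = (d : ℂ) ^ ((w + 1) * r) := by
    simp
  rw [hc, inv_mul_cancel₀ (pow_ne_zero _ natCast_ne_zero), one_smul]

theorem inner_xOp_left (t : Edge w r → ZMod d) (ψ φ : Hilb d w r) :
    inner ℂ (xOp t ψ) φ = inner ℂ ψ (xOp (-t) φ) := by
  rw [PiLp.inner_apply, PiLp.inner_apply,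
    ← Equiv.sum_comp (Equiv.addRight t) fun c => inner ℂ (xOp t ψ c) (φ c)]
  refine Finset.sum_congr rfl fun c _ => ?_
  simp [xOp_apply]

theorem inner_diagOp (f : (Edge w r → ZMod d) → ℂ) (ψ φ : Hilb d w r) :
    inner ℂ (diagOp f ψ) φ = inner ℂ ψ (diagOp (star f) φ) := by
  rw [PiLp.inner_apply, PiLp.inner_apply]
  refine Finset.sum_congr rfl fun c _ => ?_
  simp [diagOp_apply]
  ring

theorem vertexMeas_isSymmetric (a : Vertex w r → ZMod d) : (vertexMeas a).IsSymmetric := by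
  intro ψ φ
  rw [vertexMeas_eq]
  simp only [LinearMap.smul_apply, LinearMap.sum_apply, inner_smul_left, inner_smul_right,
    sum_inner, inner_sum]
  congr 1
  · simp
  rw [← Equiv.sum_comp (Equiv.neg _)
    fun k => pairing a k * inner ℂ ψ (xOp (coboundary k) φ)]
  refine Finset.sum_congr rfl fun k _ => ?_
  rw [Equiv.neg_apply, pairing_neg_right, coboundary_neg, inner_xOp_left]

theorem faceMeas_isSymmetric (b : Face w r → ZMod d) : (faceMeas b).IsSymmetric := by
  intro ψ φ
  rw [faceMeas_eq, inner_diagOp]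
  congr 3
  ext c
  simp [apply_ite]

theorem faceMeas_mul_self (b : Face w r → ZMod d) : faceMeas b * faceMeas b = faceMeas b := by
  ext ψ c
  simp only [Module.End.mul_apply, faceMeas_apply]
  split_ifs <;> rfl

theorem vertexMeas_commute_faceMeas (a : Vertex w r → ZMod d) (b : Face w r → ZMod d) :
    Commute (vertexMeas a) (faceMeas b) := by
  ext ψ c
  simp only [Module.End.mul_apply, faceMeas_apply, vertexMeas_apply, flux_sub, flux_coboundary,
    sub_zero]
  split_ifs <;> simp

theorem inner_syndromeProj_self (a : Vertex w r → ZMod d) (b : Face w r → ZMod d)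
    (ψ : Hilb d w r) :
    inner ℂ (syndromeProj a b ψ) (syndromeProj a b ψ) = inner ℂ ψ (syndromeProj a b ψ) := by
  have h : syndromeProj a b * syndromeProj a b = syndromeProj a b := by
    rw [syndromeProj_eq, (vertexMeas_commute_faceMeas a b).symm.mul_mul_mul_comm,
      vertexMeas_mul_self, faceMeas_mul_self]
  have h' (φ : Hilb d w r) : inner ℂ (syndromeProj a b ψ) φ = inner ℂ ψ (syndromeProj a b φ) := by
    rw [syndromeProj_eq, Module.End.mul_apply, vertexMeas_isSymmetric, faceMeas_isSymmetric,
      ← Module.End.mul_apply, (vertexMeas_commute_faceMeas a b).eq]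
  rw [h', ← Module.End.mul_apply, h]

theorem sum_vertexMeas : ∑ a, vertexMeas a = (1 : Module.End ℂ (Hilb d w r)) := by
  simp_rw [vertexMeas_eq]
  rw [← Finset.smul_sum, Finset.sum_comm]
  simp_rw [← Finset.sum_smul, sum_pairing_left, ite_smul, zero_smul]
  rw [Finset.sum_ite_eq' Finset.univ 0, if_pos (Finset.mem_univ _), smul_smul]
  have hc : Fintype.card (Vertex w r) = (w + 1) * r := by simp
  rw [hc, inv_mul_cancel₀ (pow_ne_zero _ natCast_ne_zero), one_smul, coboundary_zero, xOp_zero]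

theorem sum_faceMeas : ∑ b, faceMeas b = (1 : Module.End ℂ (Hilb d w r)) := by
  ext ψ c
  have h (b : Face w r → ZMod d) : (∀ p, flux p c = b p) ↔ (fun p => flux p c) = b := by
    rw [funext_iff]
  simp only [LinearMap.sum_apply, WithLp.ofLp_sum, Finset.sum_apply, faceMeas_apply, h]
  simp

theorem sum_syndromeProj :
    ∑ a, ∑ b, syndromeProj a b = (1 : Module.End ℂ (Hilb d w r)) := by
  simp_rw [syndromeProj_eq, ← Finset.mul_sum, sum_faceMeas, mul_one, sum_vertexMeas]

theorem syndromeProj_apply (a : Vertex w r → ZMod d) (b : Face w r → ZMod d) (ψ : Hilb d w r)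
    (c : Edge w r → ZMod d) :
    syndromeProj a b ψ c = if ∀ p, flux p c = b p then
      ((d : ℂ) ^ ((w + 1) * r))⁻¹ * ∑ k, pairing a k * ψ (c - coboundary k) else 0 := by
  rw [syndromeProj_eq, (vertexMeas_commute_faceMeas a b).eq, Module.End.mul_apply, faceMeas_apply,
    vertexMeas_apply]

/-- On a state that is invariant under all vertex operators, the measurement only selects the
labellings with the given flux. -/
theorem syndromeProj_zero_left_apply {b : Face w r → ZMod d} {ψ : Hilb d w r}
    (hψ : ∀ k c, ψ (c - coboundary k) = ψ c) (c : Edge w r → ZMod d) :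
    syndromeProj 0 b ψ c = if ∀ p, flux p c = b p then ψ c else 0 := by
  rw [syndromeProj_apply]
  simp [pairing_zero_left, hψ, NeZero.ne d]

/-- A state that is invariant under `A_v ^ k` only has outcomes at `v` that are trivial. -/
theorem syndromeProj_eq_zero_of_vertex {a : Vertex w r → ZMod d} (b : Face w r → ZMod d)
    {ψ : Hilb d w r} {v : Vertex w r} (ha : a v ≠ 0)
    (hψ : ∀ c, ψ (c - coboundary (Pi.single v 1)) = ψ c) : syndromeProj a b ψ = 0 := by
  have h1 : xOp (coboundary (Pi.single v 1)) ψ = ψ := by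
    ext c
    exact hψ c
  have h2 : vertexMeas a ψ = pairing a (-Pi.single v 1) • vertexMeas a ψ := by
    conv_lhs => rw [← h1, ← Module.End.mul_apply, vertexMeas_mul_xOp, LinearMap.smul_apply]
  have h3 : pairing a (-Pi.single v 1) ≠ 1 := by
    intro h
    rw [pairing, ← qpow_zero_right (d := d) 1] at h
    have := qpow_one_injective h
    simp [Pi.single_apply] at this
    exact ha this
  have h4 : vertexMeas a ψ = 0 := by
    have : (pairing a (-Pi.single v 1) - 1) • vertexMeas a ψ = 0 := by
      rw [sub_smul, one_smul, ← h2, sub_self]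
    exact (smul_eq_zero.mp this).resolve_left (sub_ne_zero.mpr h3)
  rw [syndromeProj_eq, (vertexMeas_commute_faceMeas a b).eq, Module.End.mul_apply, h4, map_zero]

theorem syndromeProj_eq_zero_of_face (a : Vertex w r → ZMod d) {b : Face w r → ZMod d}
    {ψ : Hilb d w r} {p : Face w r} (hψ : ∀ c, flux p c = b p → ψ c = 0) :
    syndromeProj a b ψ = 0 := by
  have : faceMeas b ψ = 0 := by
    ext c
    rw [faceMeas_apply]
    split_ifs with h
    · exact hψ c (h p)
    · rfl
  rw [syndromeProj_eq, Module.End.mul_apply, this, map_zero]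

/-! ### The two bases of the vacuum -/

open Classical in
theorem ketZero_apply (x : Fin (w + 1)) (c : Edge w r → ZMod d) :
    ketZero d w r c =
      if IsFlat c ∧ colSum x c = 0 then ((d : ℂ) ^ ((w + 1) * r))⁻¹ else 0 := by
  have h : ketZero d w r = vertexMeas 0 (EuclideanSpace.single 0 1) := rfl
  rw [h, vertexMeas_apply]
  simp_rw [pairing_zero_left, one_mul, PiLp.single_apply, sub_eq_zero, ← exists_coboundary_iff]
  split_ifs with hc
  · obtain ⟨k, rfl⟩ := hc
    simp [coboundary_injective.eq_iff]
  · rw [Finset.sum_eq_zero fun k _ => if_neg fun hk => hc ⟨k, hk.symm⟩, mul_zero]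

theorem xString_apply (y : Fin (r + 1)) (i : ZMod d) (ψ : Hilb d w r) (c : Edge w r → ZMod d) :
    xString y i ψ c = ψ (c - rowString y i) := by
  have : (xString y i : Module.End ℂ (Hilb d w r)) = xOp (rowString y i) := by
    unfold xString
    congr 1
  rw [this, xOp_apply]

theorem zString_apply (x : Fin (w + 1)) (i : ZMod d) (ψ : Hilb d w r) (c : Edge w r → ZMod d) :
    zString x i ψ c = qpow d (-i) (colSum x c) * ψ c := by
  rw [zString, zOp_apply]
  congr 1
  simp [pairing, Fintype.sum_prod_type, colSum, qpow, Finset.mul_sum, Finset.sum_ite_irrel]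

open Classical in
/-- The logical state `|i⟩_L` is the uniform superposition of the flat labellings in which each
column sums to `i`. -/
theorem ket_apply (x : Fin (w + 1)) (y : Fin (r + 1)) (i : ZMod d) (c : Edge w r → ZMod d) :
    (ket y i : Hilb d w r) c =
      if IsFlat c ∧ colSum x c = i then ((d : ℂ) ^ ((w + 1) * r))⁻¹ else 0 := by
  rw [ket, xString_apply, ketZero_apply x]
  simp [IsFlat, flux_sub, flux_rowString, colSum_sub, colSum_rowString, sub_eq_zero]

theorem zString_ket (x : Fin (w + 1)) (y : Fin (r + 1)) (i k : ZMod d) :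
    zString x i (ket y k : Hilb d w r) = qpow d (-i) k • ket y k := by
  ext c
  rw [zString_apply, PiLp.smul_apply, ket_apply x, smul_eq_mul]
  split_ifs with h
  · rw [h.2]
  · simp

theorem xString_ket (y y' : Fin (r + 1)) (i k : ZMod d) :
    xString y i (ket y' k : Hilb d w r) = ket y' (k + i) := by
  ext c
  rw [xString_apply, ket_apply 0, ket_apply 0]
  simp [IsFlat, flux_sub, flux_rowString, colSum_sub, colSum_rowString, sub_eq_iff_eq_add]

theorem deltaKet_eq (x : Fin (w + 1)) (y : Fin (r + 1)) (i : ZMod d) :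
    (deltaKet x y i : Hilb d w r) = ∑ k, qpow d (-i) k • ket y k := by
  simp [deltaKet, zString_ket]

theorem ket_eq_sum_deltaKet (x : Fin (w + 1)) (y : Fin (r + 1)) (k : ZMod d) :
    (ket y k : Hilb d w r) = (d : ℂ)⁻¹ • ∑ i, qpow d i k • deltaKet x y i := by
  simp_rw [deltaKet_eq, Finset.smul_sum (s := Finset.univ) (r := qpow d _ k), smul_smul]
  rw [Finset.sum_comm]
  have h (k' : ZMod d) : ∑ i, (qpow d i k * qpow d (-i) k') • (ket y k' : Hilb d w r) =
      if k' = k then (d : ℂ) • ket y k' else 0 := by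
    simp_rw [← Finset.sum_smul, qpow_neg_left, ← qpow_add_right]
    rw [sum_qpow]
    by_cases hk : k' = k
    · simp [hk]
    · rw [if_neg hk, if_neg, zero_smul]
      rwa [← sub_eq_add_neg, sub_eq_zero, eq_comm]
  simp_rw [h]
  simp [smul_smul]

theorem mem_vac_iff (ψ : Hilb d w r) : ψ ∈ vac d w r ↔
    (∀ k c, ψ (c - coboundary k) = ψ c) ∧ ∀ c, ¬ IsFlat c → ψ c = 0 := by
  have hv : ψ ∈ vac d w r ↔ (∀ v, vertexProj v 0 ψ = ψ) ∧ ∀ p, faceProj p 0 ψ = ψ := by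
    simp [vac, Submodule.mem_iInf]
  rw [hv]
  refine ⟨fun ⟨h1, h2⟩ => ⟨fun k c => ?_, fun c hc => ?_⟩,
    fun ⟨h1, h2⟩ => ⟨fun v => ?_, fun p => ?_⟩⟩
  · have h3 : vertexMeas 0 ψ = ψ :=
      Finset.noncommProd_induction _ _ _ (fun f : Module.End ℂ (Hilb d w r) => f ψ = ψ)
        (fun f g hf hg => by rw [Module.End.mul_apply, hg, hf]) rfl fun v _ => h1 v
    have h4 : xOp (coboundary k) ψ = ψ := by
      have h5 : xOp (coboundary k) * vertexMeas 0 = vertexMeas 0 * xOp (coboundary k) := by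
        rw [vertexMeas_eq, mul_smul_comm, smul_mul_assoc, Finset.mul_sum, Finset.sum_mul]
        congr 1
        refine Finset.sum_congr rfl fun k' _ => ?_
        rw [mul_smul_comm, smul_mul_assoc, (xOp_commute _ _).eq]
      rw [← h3, ← Module.End.mul_apply, h5, vertexMeas_mul_xOp, pairing_zero_left, one_smul]
    rw [← xOp_apply, h4]
  · rw [IsFlat, not_forall] at hc
    obtain ⟨p, hp⟩ := hc
    have := congrArg (fun φ : Hilb d w r => φ c) (h2 p)
    rw [faceProj] at this
    simpa [diagOp_apply, hp, eq_comm] using this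
  · ext c
    have : ∀ l, vertexAct v l ψ = ψ := by
      intro l
      ext c
      rw [vertexAct, xOp_apply, ← coboundary_single, h1]
    simp [vertexProj, qpow_zero_left, this, NeZero.ne d]
  · ext c
    rw [faceProj, diagOp_apply]
    split_ifs with hp
    · rw [one_mul]
    · rw [zero_mul, h2 c fun hc => hp (hc p)]

theorem ket_mem_vac (y : Fin (r + 1)) (i : ZMod d) : (ket y i : Hilb d w r) ∈ vac d w r := by
  rw [mem_vac_iff]
  refine ⟨fun k c => ?_, fun c hc => ?_⟩
  · rw [ket_apply 0, ket_apply 0]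
    simp [IsFlat, flux_sub, flux_coboundary, colSum_sub, colSum_coboundary]
  · rw [ket_apply 0, if_neg fun h => hc h.1]

theorem isFlat_rowString (y : Fin (r + 1)) (i : ZMod d) :
    IsFlat (rowString y i : Edge w r → ZMod d) := fun p => flux_rowString p y i

theorem ket_linearIndependent (y : Fin (r + 1)) :
    LinearIndependent ℂ (fun i : ZMod d => (ket y i : Hilb d w r)) := by
  rw [Fintype.linearIndependent_iff]
  intro g hg i
  have := congrArg (fun φ : Hilb d w r => φ (rowString y i)) hg
  simpa [ket_apply 0, isFlat_rowString, colSum_rowString, NeZero.ne d] using this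

theorem span_ket (y : Fin (r + 1)) :
    Submodule.span ℂ (Set.range fun i : ZMod d => (ket y i : Hilb d w r)) = vac d w r := by
  refine le_antisymm (Submodule.span_le.mpr ?_) fun ψ hψ => ?_
  · rintro _ ⟨i, rfl⟩
    exact ket_mem_vac y i
  · rw [mem_vac_iff] at hψ
    have : ψ = ∑ i, ((d : ℂ) ^ ((w + 1) * r) * ψ (rowString y i)) • ket y i := by
      ext c
      simp only [WithLp.ofLp_sum, WithLp.ofLp_smul, Finset.sum_apply, Pi.smul_apply, ket_apply 0]
      by_cases hc : IsFlat c
      · have h1 : IsFlat (c - rowString y (colSum 0 c)) ∧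
            colSum 0 (c - rowString y (colSum 0 c)) = 0 := by
          simp [IsFlat, flux_sub, hc _, flux_rowString, colSum_sub, colSum_rowString]
        obtain ⟨k, hk⟩ := (exists_coboundary_iff _ 0).mpr h1
        rw [← hψ.1 k c, hk]
        simp only [hc, true_and, smul_eq_mul, mul_ite, mul_zero, Finset.sum_ite_eq,
          Finset.mem_univ, if_true, sub_sub_cancel]
        rw [mul_right_comm, mul_inv_cancel₀ (pow_ne_zero _ natCast_ne_zero), one_mul]
      · simp [hc, hψ.2 c hc]
    rw [this]
    exact Submodule.sum_mem _ fun i _ => Submodule.smul_mem _ _ (Submodule.subset_span ⟨i, rfl⟩)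

theorem span_deltaKet (x : Fin (w + 1)) (y : Fin (r + 1)) :
    Submodule.span ℂ (Set.range fun i : ZMod d => (deltaKet x y i : Hilb d w r)) = vac d w r := by
  rw [← span_ket y]
  refine le_antisymm (Submodule.span_le.mpr ?_) (Submodule.span_le.mpr ?_)
  · rintro _ ⟨i, rfl⟩
    change deltaKet x y i ∈ _
    rw [deltaKet_eq]
    exact Submodule.sum_mem _ fun i _ => Submodule.smul_mem _ _ (Submodule.subset_span ⟨i, rfl⟩)
  · rintro _ ⟨k, rfl⟩
    change ket y k ∈ _
    rw [ket_eq_sum_deltaKet x]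
    exact Submodule.smul_mem _ _ <|
      Submodule.sum_mem _ fun i _ => Submodule.smul_mem _ _ (Submodule.subset_span ⟨i, rfl⟩)

theorem deltaKet_linearIndependent (x : Fin (w + 1)) (y : Fin (r + 1)) :
    LinearIndependent ℂ (fun i : ZMod d => (deltaKet x y i : Hilb d w r)) := by
  rw [linearIndependent_iff_card_eq_finrank_span, Set.finrank, span_deltaKet, ← span_ket y,
    finrank_span_eq_card (ket_linearIndependent y)]

/-! ### Measurements through an ancilla -/

section Measurement

variable {V W : Type*} [NormedAddCommGroup V] [InnerProductSpace ℂ V] [FiniteDimensional ℂ V]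
  [NormedAddCommGroup W] [InnerProductSpace ℂ W]

/-- Eigenvectors of an isometry for different eigenvalues are orthogonal, so that the orthogonal
projection onto an eigenspace is diagonal on eigenvectors. -/
theorem outcomeProj_of_eigenvector {U : Module.End ℂ V}
    (hU : ∀ x y, inner ℂ (U x) (U y) = inner ℂ x y) {x : V} {m : ZMod d}
    (hx : U x = qpow d 1 m • x) (n : ZMod d) :
    outcomeProj U n x = if m = n then x else 0 := by
  have hmem : x ∈ Module.End.eigenspace U (qpow d 1 m) := Module.End.mem_eigenspace_iff.mpr hx
  rw [outcomeProj]
  split_ifs with h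
  · subst h
    exact Submodule.starProjection_eq_self_iff.mpr hmem
  · refine Submodule.eq_starProjection_of_mem_orthogonal (Submodule.zero_mem _) ?_
    rw [sub_zero, Submodule.mem_orthogonal]
    intro y hy
    have hy' := Module.End.mem_eigenspace_iff.mp hy
    have h1 := hU y x
    rw [hy', hx, inner_smul_left, inner_smul_right, conj_qpow, ← mul_assoc, ← qpow_add_right] at h1
    have h2 : (qpow d 1 (-n + m) - 1) * inner ℂ y x = 0 := by rw [sub_mul, h1, one_mul, sub_self]
    refine (mul_eq_zero.mp h2).resolve_left fun h3 => h ?_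
    rw [sub_eq_zero, ← qpow_zero_right (d := d) 1] at h3
    have := qpow_one_injective h3
    rwa [neg_add_eq_zero, eq_comm] at this

/-- A measurement with projections `S s` after an initialisation `init` realises the measurement of
`U`, on the span of eigenvectors `u i` of `U`, if an outcome `s` excludes the `u i` whose
eigenvalue is not the one that is read off from `s`. -/
theorem measurement_realises {σ ι : Type*} [Fintype σ] {U : Module.End ℂ V}
    (hU : ∀ x y, inner ℂ (U x) (U y) = inner ℂ x y)
    {init : V →ₗ[ℂ] W} {C : ℝ} (hC : 0 < C) (hinit : ∀ x, ‖init x‖ ^ 2 = C * ‖x‖ ^ 2)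
    {S : σ → Module.End ℂ W} (hS : ∀ s x, inner ℂ (S s x) (S s x) = inner ℂ x (S s x))
    {f : σ → ZMod d} {u : ι → V} {ev : ι → ZMod d} (hu : ∀ i, U (u i) = qpow d 1 (ev i) • u i)
    (h0 : ∀ s i, ev i ≠ f s → S s (init (u i)) = 0)
    (hsum : ∀ i, ∑ s, S s (init (u i)) = init (u i))
    {Ψ : V} (hΨ : Ψ ∈ Submodule.span ℂ (Set.range u)) :
    (∀ s, S s (init Ψ) = S s (init (outcomeProj U (f s) Ψ))) ∧
      ∀ n, ∑ s with f s = n, prob (S s) (init Ψ) = prob (outcomeProj U n) Ψ := by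
  have hstate (s : σ) : S s (init Ψ) = S s (init (outcomeProj U (f s) Ψ)) := by
    refine LinearMap.eqOn_span (f := S s ∘ₗ init) (g := S s ∘ₗ init ∘ₗ outcomeProj U (f s)) ?_ hΨ
    rintro _ ⟨i, rfl⟩
    simp only [LinearMap.comp_apply, outcomeProj_of_eigenvector hU (hu i)]
    split_ifs with h
    · rfl
    · rw [h0 s i h, map_zero, map_zero]
  refine ⟨hstate, fun n => ?_⟩
  -- Outcomes `s` with `f s ≠ n` do not occur in the component with result `q ^ n`.
  have hne (s : σ) (hs : f s ≠ n) : S s (init (outcomeProj U n Ψ)) = 0 := by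
    refine LinearMap.eqOn_span (f := S s ∘ₗ init ∘ₗ outcomeProj U n) (g := 0) ?_ hΨ
    rintro _ ⟨i, rfl⟩
    simp only [LinearMap.comp_apply, outcomeProj_of_eigenvector hU (hu i), LinearMap.zero_apply]
    split_ifs with h
    · exact h0 s i (h ▸ hs.symm)
    · rw [map_zero, map_zero]
  have htotal : ∑ s, S s (init (outcomeProj U n Ψ)) = init (outcomeProj U n Ψ) := by
    have := LinearMap.eqOn_span (f := ∑ s, S s ∘ₗ init ∘ₗ outcomeProj U n)
      (g := init ∘ₗ outcomeProj U n) ?_ hΨ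
    · simpa using this
    rintro _ ⟨i, rfl⟩
    simp only [LinearMap.sum_apply, LinearMap.comp_apply, outcomeProj_of_eigenvector hU (hu i)]
    split_ifs with h
    · exact hsum i
    · simp
  have hnorm : ∑ s with f s = n, ‖S s (init Ψ)‖ ^ 2 = ‖init (outcomeProj U n Ψ)‖ ^ 2 := by
    have h1 : ∑ s with f s = n, ‖S s (init Ψ)‖ ^ 2 = ∑ s, ‖S s (init (outcomeProj U n Ψ))‖ ^ 2 := by
      rw [Finset.sum_filter]
      refine Finset.sum_congr rfl fun s _ => ?_
      split_ifs with h
      · rw [hstate, h]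
      · rw [hne s h, norm_zero, zero_pow two_ne_zero]
    rw [h1, @norm_sq_eq_re_inner ℂ]
    nth_rw 3 [← htotal]
    rw [inner_sum, map_sum]
    exact Finset.sum_congr rfl fun s _ => by rw [@norm_sq_eq_re_inner ℂ, hS]
  simp only [prob]
  rw [← Finset.sum_div, hnorm, hinit, hinit, mul_div_mul_left _ _ hC.ne']

end Measurement

/-! ### Tensor products of patches -/

section TensorProduct

variable {E F G : Type*} [NormedAddCommGroup E] [InnerProductSpace ℂ E]
  [NormedAddCommGroup F] [InnerProductSpace ℂ F] [NormedAddCommGroup G] [InnerProductSpace ℂ G]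

theorem inner_map_of_inner {f : Module.End ℂ E} {g : Module.End ℂ F}
    (hf : ∀ x y, inner ℂ (f x) (f y) = inner ℂ x y) (hg : ∀ x y, inner ℂ (g x) (g y) = inner ℂ x y)
    (x y : E ⊗[ℂ] F) :
    inner ℂ (TensorProduct.map f g x) (TensorProduct.map f g y) = inner ℂ x y :=
  TensorProduct.inner_map_map (f.isometryOfInner hf) (g.isometryOfInner hg) x y

theorem norm_sq_of_inner_tmul {T : E ⊗[ℂ] F →ₗ[ℂ] G} {C : ℝ}
    (hT : ∀ a b a' b', inner ℂ (T (a ⊗ₜ b)) (T (a' ⊗ₜ b')) = C * (inner ℂ a a' * inner ℂ b b'))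
    (x : E ⊗[ℂ] F) : ‖T x‖ ^ 2 = C * ‖x‖ ^ 2 := by
  have h (x y : E ⊗[ℂ] F) : inner ℂ (T x) (T y) = C * inner ℂ x y := by
    induction x with
    | zero => simp
    | add x₁ x₂ h₁ h₂ => rw [map_add, inner_add_left, inner_add_left, h₁, h₂, mul_add]
    | tmul a b =>
      induction y with
      | zero => simp
      | add y₁ y₂ h₁ h₂ => rw [map_add, inner_add_right, inner_add_right, h₁, h₂, mul_add]
      | tmul a' b' => rw [hT, TensorProduct.inner_tmul]
  rw [@norm_sq_eq_re_inner ℂ, @norm_sq_eq_re_inner ℂ, h]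
  exact Complex.re_ofReal_mul _ _

end TensorProduct

theorem inner_xString (y : Fin (r + 1)) (i : ZMod d) (ψ φ : Hilb d w r) :
    inner ℂ (xString y i ψ) (xString y i φ) = inner ℂ ψ φ := by
  rw [xString, inner_xOp_left, ← Module.End.mul_apply, ← xOp_add, neg_add_cancel, xOp_zero,
    Module.End.one_apply]

theorem inner_zString (x : Fin (w + 1)) (i : ZMod d) (ψ φ : Hilb d w r) :
    inner ℂ (zString x i ψ) (zString x i φ) = inner ℂ ψ φ := by
  rw [PiLp.inner_apply, PiLp.inner_apply]
  refine Finset.sum_congr rfl fun c _ => ?_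
  rw [zString_apply, zString_apply]
  simp only [RCLike.inner_apply, map_mul, conj_qpow]
  linear_combination (φ c * starRingEnd ℂ (ψ c)) * qpow_mul_neg (-i) (colSum x c)

theorem pairVac_eq_span {w₁ r₁ w₂ r₂ : ℕ} {u : ZMod d → Hilb d w₁ r₁} {v : ZMod d → Hilb d w₂ r₂}
    (hu : Submodule.span ℂ (Set.range u) = vac d w₁ r₁)
    (hv : Submodule.span ℂ (Set.range v) = vac d w₂ r₂) :
    pairVac d w₁ r₁ w₂ r₂ =
      Submodule.span ℂ (Set.range fun i : ZMod d × ZMod d => u i.1 ⊗ₜ[ℂ] v i.2) := by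
  rw [pairVac, TensorProduct.range_mapIncl, ← hu, ← hv, Submodule.map₂_span_span,
    Set.image2_range]
  rfl

/-- If the outcomes outside of the range of the injective map `g` do not occur, those in the range
make up the whole state. -/
theorem sum_syndromeProj_of_injective {σ : Type*} [Fintype σ]
    {g : σ → (Vertex w r → ZMod d) × (Face w r → ZMod d)} (hg : Function.Injective g)
    {ψ : Hilb d w r} (h : ∀ ab ∉ Set.range g, syndromeProj ab.1 ab.2 ψ = 0) :
    ∑ s, syndromeProj (g s).1 (g s).2 ψ = ψ := by
  rw [Fintype.sum_of_injective g hg _ (fun ab => syndromeProj ab.1 ab.2 ψ) h fun _ => rfl,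
    Fintype.sum_prod_type]
  simpa using congrArg (fun T : Module.End ℂ (Hilb d w r) => T ψ) sum_syndromeProj

/-- If the edges are split into two patches and a seam, the labellings are independent. -/
theorem sum_comp_mul_comp {A B S E : Type*} [Fintype A] [Fintype B] [Fintype S] [Fintype E]
    [DecidableEq A] [DecidableEq B] [DecidableEq S] [DecidableEq E]
    {f : A → E} {g : B → E} {h : S → E}
    (hb : Function.Bijective (Sum.elim f (Sum.elim g h)))
    (F : (A → ZMod d) → ℂ) (G : (B → ZMod d) → ℂ) (H : (S → ZMod d) → ℂ) :
    ∑ c : E → ZMod d, F (c ∘ f) * G (c ∘ g) * H (c ∘ h) =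
      (∑ a, F a) * (∑ b, G b) * ∑ s, H s := by
  let e := (Equiv.arrowCongr (Equiv.ofBijective _ hb).symm (Equiv.refl (ZMod d))).trans
    ((Equiv.sumArrowEquivProdArrow A (B ⊕ S) (ZMod d)).trans
      (Equiv.prodCongr (Equiv.refl _) (Equiv.sumArrowEquivProdArrow B S (ZMod d))))
  have he (c : E → ZMod d) : e c = (c ∘ f, c ∘ g, c ∘ h) := rfl
  have : ∑ c : E → ZMod d, F (c ∘ f) * G (c ∘ g) * H (c ∘ h) =
      ∑ c, F (e c).1 * G (e c).2.1 * H (e c).2.2 := by simp [he]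
  rw [this, Equiv.sum_comp e fun x => F x.1 * G x.2.1 * H x.2.2, Fintype.sum_prod_type]
  simp_rw [Fintype.sum_prod_type, ← Finset.mul_sum, ← Finset.sum_mul, mul_assoc, ← Finset.mul_sum,
    ← Finset.sum_mul, mul_assoc]

/-! ### Encodings of the two algebras -/

section Encode

variable {V₁ V₂ W : Type*} [AddCommGroup V₁] [Module ℂ V₁] [AddCommGroup V₂] [Module ℂ V₂]
  [AddCommGroup W] [Module ℂ W]

theorem groupEncode_zero (u : ZMod d → W) : groupEncode u 0 = 0 := by simp [groupEncode]

theorem groupEncode_add (u : ZMod d → W) (a b : AddMonoidAlgebra ℂ (ZMod d)) :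
    groupEncode u (a + b) = groupEncode u a + groupEncode u b := by
  simp [groupEncode, add_smul, Finset.sum_add_distrib]

theorem groupEncode_single (u : ZMod d → W) (i : ZMod d) (z : ℂ) :
    groupEncode u (AddMonoidAlgebra.single i z) = z • u i := by
  simp [groupEncode, Finsupp.single_apply]

theorem map_groupEncode_tmul {K : V₁ ⊗[ℂ] V₂ →ₗ[ℂ] W} {u : ZMod d → V₁} {v : ZMod d → V₂}
    {t : ZMod d → W} (h : ∀ i j, K (u i ⊗ₜ v j) = t (i + j)) (a b : AddMonoidAlgebra ℂ (ZMod d)) :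
    K (groupEncode u a ⊗ₜ groupEncode v b) = groupEncode t (a * b) := by
  induction a using AddMonoidAlgebra.induction_linear with
  | zero => simp [groupEncode_zero]
  | add a₁ a₂ h₁ h₂ =>
      rw [groupEncode_add, TensorProduct.add_tmul, map_add, h₁, h₂, add_mul, groupEncode_add]
  | single i z =>
    induction b using AddMonoidAlgebra.induction_linear with
    | zero => simp [groupEncode_zero]
    | add b₁ b₂ h₁ h₂ =>
        rw [groupEncode_add, TensorProduct.tmul_add, map_add, h₁, h₂, mul_add, groupEncode_add]
    | single j z' =>
      rw [AddMonoidAlgebra.single_mul_single, groupEncode_single, groupEncode_single,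
        groupEncode_single, TensorProduct.smul_tmul_smul, map_smul, h]

theorem map_functionEncode_tmul {K : V₁ ⊗[ℂ] V₂ →ₗ[ℂ] W} {u : ZMod d → V₁} {v : ZMod d → V₂}
    {t : ZMod d → W} (h : ∀ i j, K (u i ⊗ₜ v j) = if i = j then t i else 0) (f g : ZMod d → ℂ) :
    K (functionEncode u f ⊗ₜ functionEncode v g) = functionEncode t (f * g) := by
  simp only [functionEncode, TensorProduct.sum_tmul, TensorProduct.tmul_sum,
    TensorProduct.smul_tmul_smul, map_sum, map_smul, h, Pi.mul_apply]
  simp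

end Encode

/-! ### Smooth merges -/

section Smooth

variable {w₁ w₂ : ℕ}

theorem colSum_comp_leftEdge (c : Edge (w₁ + 1 + w₂) r → ZMod d) :
    colSum 0 (c ∘ leftEdge : Edge w₁ r → ZMod d) = colSum 0 c := rfl

theorem colSum_comp_rightEdge (c : Edge (w₁ + 1 + w₂) r → ZMod d) :
    colSum (Fin.last w₂) (c ∘ rightEdge : Edge w₂ r → ZMod d) = colSum (Fin.last _) c := rfl

theorem flux_comp_leftEdge (p : Face w₁ r) (c : Edge (w₁ + 1 + w₂) r → ZMod d) :
    flux p (c ∘ leftEdge) = flux (Fin.castAdd w₂ p.1.castSucc, p.2) c := by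
  rw [flux_eq, flux_eq]
  rfl

theorem flux_comp_rightEdge (p : Face w₂ r) (c : Edge (w₁ + 1 + w₂) r → ZMod d) :
    flux p (c ∘ rightEdge) = flux (Fin.natAdd (w₁ + 1) p.1, p.2) c := by
  rw [flux_eq, flux_eq]
  rfl

theorem isFlat_comp_leftEdge_and_rightEdge (c : Edge (w₁ + 1 + w₂) r → ZMod d) :
    (IsFlat (c ∘ leftEdge : Edge w₁ r → ZMod d) ∧ IsFlat (c ∘ rightEdge : Edge w₂ r → ZMod d)) ↔
      ∀ p : Face (w₁ + 1 + w₂) r, p.1 ≠ smoothSeam w₁ w₂ → flux p c = 0 := by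
  constructor
  · rintro ⟨h1, h2⟩ ⟨x, y⟩ hp
    induction x using Fin.addCases with
    | left x =>
      induction x using Fin.lastCases with
      | last => exact absurd rfl hp
      | cast x => exact (flux_comp_leftEdge (x, y) c).symm.trans (h1 _)
    | right x => exact (flux_comp_rightEdge (x, y) c).symm.trans (h2 _)
  · intro h
    refine ⟨fun p => ?_, fun p => ?_⟩
    · rw [flux_comp_leftEdge]
      refine h _ fun hp => ?_
      simp only [smoothSeam, Fin.ext_iff, Fin.val_castAdd, Fin.val_castSucc, Fin.val_last] at hp
      have := p.1.2
      omega
    · rw [flux_comp_rightEdge]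
      refine h _ fun hp => ?_
      simp only [smoothSeam, Fin.ext_iff, Fin.val_castAdd, Fin.val_natAdd, Fin.val_last] at hp
      omega

theorem smoothInit_tmul_apply (ψ : Hilb d w₁ r) (φ : Hilb d w₂ r)
    (c : Edge (w₁ + 1 + w₂) r → ZMod d) :
    smoothInit d w₁ w₂ r (ψ ⊗ₜ φ) c = ψ (c ∘ leftEdge) * φ (c ∘ rightEdge) := rfl

open Classical in
theorem smoothInit_ket_apply (y₁ y₂ : Fin (r + 1)) (i j : ZMod d)
    (c : Edge (w₁ + 1 + w₂) r → ZMod d) :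
    smoothInit d w₁ w₂ r (ket y₁ i ⊗ₜ ket y₂ j) c =
      if (∀ p : Face (w₁ + 1 + w₂) r, p.1 ≠ smoothSeam w₁ w₂ → flux p c = 0) ∧
        colSum 0 c = i ∧ colSum (Fin.last _) c = j then
        ((d : ℂ) ^ ((w₁ + 1 + w₂ + 1) * r))⁻¹ else 0 := by
  rw [smoothInit_tmul_apply, ket_apply 0, ket_apply (Fin.last _), colSum_comp_leftEdge,
    colSum_comp_rightEdge, ite_zero_mul_ite_zero, ← mul_inv, ← pow_add]
  have : (w₁ + 1) * r + (w₂ + 1) * r = (w₁ + 1 + w₂ + 1) * r := by ring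
  rw [this]
  congr 1
  rw [← isFlat_comp_leftEdge_and_rightEdge]
  exact propext and_and_and_comm

theorem smoothInit_ket_sub_coboundary (y₁ y₂ : Fin (r + 1)) (i j : ZMod d)
    (k : Vertex (w₁ + 1 + w₂) r → ZMod d) (c : Edge (w₁ + 1 + w₂) r → ZMod d) :
    smoothInit d w₁ w₂ r (ket y₁ i ⊗ₜ ket y₂ j) (c - coboundary k) =
      smoothInit d w₁ w₂ r (ket y₁ i ⊗ₜ ket y₂ j) c := by
  simp only [smoothInit_ket_apply, flux_sub, flux_coboundary, colSum_sub, colSum_coboundary,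
    sub_zero]

theorem syndromeProj_smoothInit_ket_eq_zero (y₁ y₂ : Fin (r + 1)) (i j : ZMod d)
    {a : Vertex (w₁ + 1 + w₂) r → ZMod d} {b : Face (w₁ + 1 + w₂) r → ZMod d}
    (h : a ≠ 0 ∨ ∃ p, p.1 ≠ smoothSeam w₁ w₂ ∧ b p ≠ 0) :
    syndromeProj a b (smoothInit d w₁ w₂ r (ket y₁ i ⊗ₜ ket y₂ j)) = 0 := by
  rcases h with h | ⟨p, hp, hb⟩
  · obtain ⟨v, hv⟩ := Function.ne_iff.mp h
    exact syndromeProj_eq_zero_of_vertex b hv (smoothInit_ket_sub_coboundary y₁ y₂ i j _)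
  · refine syndromeProj_eq_zero_of_face a (p := p) fun c hc => ?_
    rw [smoothInit_ket_apply, if_neg fun h => hb (hc ▸ h.1 p hp)]

theorem sum_smoothSyndrome (s : Fin (r + 1) → ZMod d) :
    ∑ x, ∑ y, (smoothSyndrome s : Face (w₁ + 1 + w₂) r → ZMod d) (x, y) = ∑ y, s y := by
  simp [smoothSyndrome, Finset.sum_ite_irrel]

theorem syndromeProj_smoothSyndrome_ket_eq_zero (y₁ y₂ : Fin (r + 1)) {i j : ZMod d}
    {s : Fin (r + 1) → ZMod d} (h : j - i ≠ -∑ k, s k) :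
    syndromeProj 0 (smoothSyndrome s) (smoothInit d w₁ w₂ r (ket y₁ i ⊗ₜ ket y₂ j)) = 0 := by
  ext c
  rw [syndromeProj_zero_left_apply (smoothInit_ket_sub_coboundary y₁ y₂ i j),
    smoothInit_ket_apply]
  split_ifs with h1 h2
  · have h3 := colSum_zero_sub_colSum_last c
    simp_rw [h1, sum_smoothSyndrome, h2.2.1, h2.2.2] at h3
    exact absurd (by rw [← h3, neg_sub]) h
  · rfl
  · rfl

theorem exists_isSmoothCorrection (s : Fin (r + 1) → ZMod d) :
    ∃ t : Edge (w₁ + 1 + w₂) r → ZMod d, IsSmoothCorrection s t := by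
  -- For each new face with outcome `s k`, a string from the seam to the left boundary.
  refine ⟨Sum.elim 0 fun e => if (e.1 : ℕ) ≤ w₁ then -s e.2 else 0, ?_, fun p => ?_⟩
  · rintro (e | ⟨x, y⟩)
    · rfl
    · simp only [rightEdge, Sum.elim_inr, Fin.val_natAdd]
      exact if_neg (by omega)
  · obtain ⟨x, y⟩ := p
    simp only [flux_eq, Sum.elim_inl, Sum.elim_inr, rowLabel, Pi.zero_apply, ite_self,
      Finset.sum_const_zero, smoothSyndrome, smoothSeam, Fin.ext_iff, Fin.val_castSucc,
      Fin.val_succ, Fin.val_castAdd, Fin.val_last]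
    split_ifs <;> first | omega | simp

/-- The labelling after the correction has the flux of the one before minus the outcomes, the
same sum in the last column, and `-∑ k, s k` more in the first one. -/
theorem smoothKraus_ket {s : Fin (r + 1) → ZMod d} {t : Edge (w₁ + 1 + w₂) r → ZMod d}
    (ht : IsSmoothCorrection s t) {n : ZMod d} (hn : n = -∑ k, s k) (y₁ y₂ y : Fin (r + 1))
    (i j : ZMod d) :
    smoothKraus s t (ket y₁ i ⊗ₜ[ℂ] ket y₂ j) = if i + n = j then ket y (i + n) else 0 := by
  classical
  have hlast : colSum (Fin.last _) t = 0 := by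
    rw [← colSum_comp_rightEdge]
    exact Finset.sum_eq_zero fun y _ => ht.1 _
  have hfirst : colSum 0 t = n := by
    have := colSum_zero_sub_colSum_last t
    simp_rw [ht.2, Finset.sum_neg_distrib, sum_smoothSyndrome, hlast, sub_zero] at this
    rw [this, hn]
  ext c
  have h1 : smoothKraus s t (ket y₁ i ⊗ₜ[ℂ] ket y₂ j) c =
      if IsFlat c ∧ colSum 0 c = i + n ∧ i + n = j then
        ((d : ℂ) ^ ((w₁ + 1 + w₂ + 1) * r))⁻¹ else 0 := by
    rw [smoothKraus, LinearMap.comp_apply, LinearMap.comp_apply, xOp_apply,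
      syndromeProj_zero_left_apply (smoothInit_ket_sub_coboundary y₁ y₂ i j),
      smoothInit_ket_apply, ← ite_and]
    congr 1
    simp only [flux_sub, ht.2, sub_neg_eq_add, add_eq_right, colSum_sub, hlast, hfirst, sub_zero,
      sub_eq_iff_eq_add, eq_iff_iff]
    constructor
    · rintro ⟨hc, -, hi, hj⟩
      have hc' : IsFlat c := hc
      exact ⟨hc, hi, by rw [← hi, ← hj]; exact hc'.colSum_eq _ _⟩
    · rintro ⟨hc, hi, hj⟩
      refine ⟨hc, fun p hp => ?_, hi, ?_⟩
      · rw [hc p, zero_add, smoothSyndrome, if_neg hp]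
      · rw [← hj, ← hi]
        exact hc.colSum_eq _ _
  rw [h1]
  split_ifs with h2 h3 h3
  · rw [ket_apply 0, if_pos ⟨h2.1, h2.2.1⟩]
  · exact absurd h2.2.2 h3
  · rw [ket_apply 0, if_neg fun h => h2 ⟨h.1, h.2, h3⟩]
  · rfl

theorem smoothKraus_deltaKet {s : Fin (r + 1) → ZMod d} {t : Edge (w₁ + 1 + w₂) r → ZMod d}
    (ht : IsSmoothCorrection s t) {n : ZMod d} (hn : n = -∑ k, s k) (x₁ : Fin (w₁ + 1))
    (x₂ : Fin (w₂ + 1)) (x : Fin (w₁ + 1 + w₂ + 1)) (y₁ y₂ y : Fin (r + 1)) (i j : ZMod d) :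
    smoothKraus s t (deltaKet x₁ y₁ i ⊗ₜ[ℂ] deltaKet x₂ y₂ j) =
      qpow d i n • deltaKet x y (i + j) := by
  simp only [deltaKet_eq, TensorProduct.sum_tmul, TensorProduct.tmul_sum,
    TensorProduct.smul_tmul_smul, map_sum, map_smul, smoothKraus_ket ht hn y₁ y₂ y, smul_ite,
    smul_zero, Finset.smul_sum, smul_smul]
  rw [Finset.sum_comm]
  simp only [Finset.sum_ite_eq, Finset.mem_univ, if_true]
  rw [← Equiv.sum_comp (Equiv.addRight n)
    fun k => (qpow d i n * qpow d (-(i + j)) k) • (ket y k : Hilb d (w₁ + 1 + w₂) r)]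
  refine Finset.sum_congr rfl fun k _ => ?_
  rw [Equiv.coe_addRight, neg_add, qpow_add_left, qpow_add_right (-i), qpow_neg_left i n]
  congr 1
  linear_combination (-qpow d (-i) k * qpow d (-j) (k + n)) * qpow_mul_neg i n

theorem smoothEdges_bijective : Function.Bijective
    (Sum.elim leftEdge (Sum.elim rightEdge fun y : Fin r => .inl (smoothSeam w₁ w₂, y)) :
      Edge w₁ r ⊕ Edge w₂ r ⊕ Fin r → Edge (w₁ + 1 + w₂) r) := by
  constructor
  · rintro ((⟨x, y⟩ | ⟨x, y⟩) | (⟨x, y⟩ | ⟨x, y⟩) | y)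
      ((⟨x', y'⟩ | ⟨x', y'⟩) | (⟨x', y'⟩ | ⟨x', y'⟩) | y') h <;>
    simp [leftEdge, rightEdge, smoothSeam, Fin.ext_iff] at h ⊢ <;> omega
  · rintro (⟨x, y⟩ | ⟨x, y⟩)
    · induction x using Fin.addCases with
      | left x =>
        induction x using Fin.lastCases with
        | last => exact ⟨.inr (.inr y), rfl⟩
        | cast x => exact ⟨.inl (.inl (x, y)), rfl⟩
      | right x => exact ⟨.inr (.inl (.inl (x, y))), rfl⟩
    · induction x using Fin.addCases (m := w₁ + 1) (n := w₂ + 1) with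
      | left x => exact ⟨.inl (.inr (x, y)), rfl⟩
      | right x => exact ⟨.inr (.inl (.inr (x, y))), rfl⟩

theorem norm_smoothInit_sq (Ψ : Hilb d w₁ r ⊗[ℂ] Hilb d w₂ r) :
    ‖smoothInit d w₁ w₂ r Ψ‖ ^ 2 = (d : ℝ) ^ r * ‖Ψ‖ ^ 2 := by
  refine norm_sq_of_inner_tmul (fun a b a' b' => ?_) Ψ
  rw [PiLp.inner_apply, PiLp.inner_apply, PiLp.inner_apply]
  have h := sum_comp_mul_comp (smoothEdges_bijective (w₁ := w₁) (w₂ := w₂) (r := r))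
    (fun c : Edge w₁ r → ZMod d => inner ℂ (a c) (a' c)) (fun c => inner ℂ (b c) (b' c))
    (fun _ => 1)
  have h1 : ∑ _ : Fin r → ZMod d, (1 : ℂ) = (d : ℂ) ^ r := by simp
  rw [h1] at h
  push_cast
  rw [mul_comm, ← h]
  refine Finset.sum_congr rfl fun c _ => ?_
  simp only [smoothInit_tmul_apply, RCLike.inner_apply, map_mul]
  ring

end Smooth

/-! ### Rough merges -/

section Rough

variable {w r₁ r₂ : ℕ}

theorem colSumBelow_eq_colSum_comp_bottomEdge (x : Fin (w + 1))
    (c : Edge w (r₂ + 1 + r₁) → ZMod d) :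
    colSumBelow x (r₂ + 1) c = colSum x (c ∘ bottomEdge : Edge w r₂ → ZMod d) := by
  have h := Fin.sum_univ_add (a := r₂ + 1) (b := r₁ + 1)
    fun y => if (y : ℕ) < r₂ + 1 then c (.inr (x, y)) else 0
  refine h.trans ?_
  rw [Finset.sum_eq_zero (s := Finset.univ) (f := fun y : Fin (r₁ + 1) => _) fun y _ => ?_,
    add_zero]
  · exact Finset.sum_congr rfl fun y _ => if_pos y.2
  · exact if_neg (show ¬ r₂ + 1 + (y : ℕ) < r₂ + 1 by omega)

theorem colSum_eq_bottom_add_top (x : Fin (w + 1)) (c : Edge w (r₂ + 1 + r₁) → ZMod d) :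
    colSum x c = colSum x (c ∘ bottomEdge : Edge w r₂ → ZMod d) +
      colSum x (c ∘ topEdge : Edge w r₁ → ZMod d) :=
  Fin.sum_univ_add (a := r₂ + 1) (b := r₁ + 1) fun y => c (.inr (x, y))

theorem rowLabel_roughSeam (f : Fin (r₂ + 1 + r₁) → ZMod d) :
    rowLabel f (r₂ + 1) = f (roughSeam r₁ r₂) := rowLabel_succ f (roughSeam r₁ r₂)

theorem rowLabel_bottom {f : Fin (r₂ + 1 + r₁) → ZMod d} (hf : f (roughSeam r₁ r₂) = 0) {n : ℕ}
    (hn : n ≤ r₂ + 1) : rowLabel (fun y : Fin r₂ => f (Fin.castAdd r₁ y.castSucc)) n =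
      rowLabel f n := by
  rcases n with _ | n
  · rw [rowLabel_zero, rowLabel_zero]
  · rcases Nat.lt_or_ge n r₂ with h | h
    · have h1 := rowLabel_succ (fun y : Fin r₂ => f (Fin.castAdd r₁ y.castSucc)) ⟨n, h⟩
      have h2 := rowLabel_succ f (Fin.castAdd r₁ (Fin.castSucc ⟨n, h⟩))
      exact h1.trans h2.symm
    · obtain rfl : n = r₂ := by omega
      rw [rowLabel_of_lt _ (Nat.lt_succ_self n), rowLabel_roughSeam, hf]

theorem rowLabel_top {f : Fin (r₂ + 1 + r₁) → ZMod d} (hf : f (roughSeam r₁ r₂) = 0) (n : ℕ) :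
    rowLabel (fun y : Fin r₁ => f (Fin.natAdd (r₂ + 1) y)) n = rowLabel f (r₂ + 1 + n) := by
  rcases n with _ | n
  · rw [rowLabel_zero, add_zero, rowLabel_roughSeam, hf]
  · rcases Nat.lt_or_ge n r₁ with h | h
    · have h1 := rowLabel_succ (fun y : Fin r₁ => f (Fin.natAdd (r₂ + 1) y)) ⟨n, h⟩
      have h2 := rowLabel_succ f (Fin.natAdd (r₂ + 1) ⟨n, h⟩)
      exact h1.trans h2.symm
    · rw [rowLabel_of_lt _ (by omega), rowLabel_of_lt _ (by omega)]

theorem isFlat_comp_topEdge_and_bottomEdge {c : Edge w (r₂ + 1 + r₁) → ZMod d}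
    (hc : ∀ x : Fin w, c (.inl (x, roughSeam r₁ r₂)) = 0) :
    (IsFlat (c ∘ topEdge : Edge w r₁ → ZMod d) ∧ IsFlat (c ∘ bottomEdge : Edge w r₂ → ZMod d)) ↔
      IsFlat c := by
  have htop (x : Fin w) (y : Fin (r₁ + 1)) :
      flux (x, y) (c ∘ topEdge) = flux (x, Fin.natAdd (m := r₁ + 1) (r₂ + 1) y) c := by
    have h := rowLabel_top (f := fun y => c (.inl (x, y))) (hc x)
    rw [flux_eq, flux_eq]
    exact congrArg₂ (· - ·) (congrArg₂ (· + ·) (congrArg₂ (· - ·) (h _) (h _)) rfl) rfl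
  have hbot (x : Fin w) (y : Fin (r₂ + 1)) :
      flux (x, y) (c ∘ bottomEdge) = flux (x, Fin.castAdd (r₁ + 1) y) c := by
    have h {n : ℕ} (hn) := rowLabel_bottom (f := fun y => c (.inl (x, y))) (hc x) (n := n) hn
    have hy := y.2
    rw [flux_eq, flux_eq]
    exact congrArg₂ (· - ·) (congrArg₂ (· + ·)
      (congrArg₂ (· - ·) (h (n := y + 1) (by omega)) (h (n := y) (by omega))) rfl) rfl
  constructor
  · rintro ⟨h1, h2⟩ ⟨x, y⟩
    induction y using Fin.addCases (m := r₂ + 1) (n := r₁ + 1) with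
    | left y => exact (hbot x y).symm.trans (h2 _)
    | right y => exact (htop x y).symm.trans (h1 _)
  · exact fun h => ⟨fun p => (htop _ _).trans (h _), fun p => (hbot _ _).trans (h _)⟩

theorem roughInit_tmul_apply (ψ : Hilb d w r₁) (φ : Hilb d w r₂)
    (c : Edge w (r₂ + 1 + r₁) → ZMod d) :
    roughInit d w r₁ r₂ (ψ ⊗ₜ φ) c = if ∀ x : Fin w, c (.inl (x, roughSeam r₁ r₂)) = 0
      then ψ (c ∘ topEdge) * φ (c ∘ bottomEdge) else 0 := rfl

theorem colSum_coboundary_comp_topEdge (x : Fin (w + 1)) (k : Vertex w (r₂ + 1 + r₁) → ZMod d) :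
    colSum x (coboundary k ∘ topEdge : Edge w r₁ → ZMod d) = k (x, roughSeam r₁ r₂) := by
  have h := colSum_eq_bottom_add_top x (coboundary k)
  rw [colSum_coboundary, ← colSumBelow_eq_colSum_comp_bottomEdge,
    colSumBelow_coboundary x (by omega), rowLabel_roughSeam] at h
  linear_combination -h

/-- In a flat labelling, the label of an edge of the seam is the difference of the sums of the
labels above its ends. -/
theorem IsFlat.roughSeam_eq {c : Edge w (r₂ + 1 + r₁) → ZMod d} (hc : IsFlat c) (x : Fin w) :
    c (.inl (x, roughSeam r₁ r₂)) = colSum x.castSucc (c ∘ topEdge : Edge w r₁ → ZMod d) -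
      colSum x.succ (c ∘ topEdge : Edge w r₁ → ZMod d) := by
  have h := rowLabel_eq c x (n := r₂ + 1) (by omega)
  rw [rowLabel_roughSeam, Finset.sum_eq_zero fun y _ => by simp [hc (x, y)],
    colSumBelow_eq_colSum_comp_bottomEdge, colSumBelow_eq_colSum_comp_bottomEdge] at h
  have h1 := hc.colSum_eq x.castSucc x.succ
  rw [colSum_eq_bottom_add_top, colSum_eq_bottom_add_top] at h1
  linear_combination h - h1

open Classical in
/-- The shifts of the initial state that enter the vertex measurements. Given a flat labelling `c`
of the merged patch with column sum `i + j`, the term at `c` vanishes for all but one choice of the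
labels of the new vertices. -/
theorem roughInit_ket_sub_coboundary (y₁ : Fin (r₁ + 1)) (y₂ : Fin (r₂ + 1)) (i j : ZMod d)
    (k : Vertex w (r₂ + 1 + r₁) → ZMod d) (c : Edge w (r₂ + 1 + r₁) → ZMod d) :
    roughInit d w r₁ r₂ (ket y₁ i ⊗ₜ ket y₂ j) (c - coboundary k) =
      if (IsFlat c ∧ colSum 0 c = i + j) ∧
        (fun x => k (x, roughSeam r₁ r₂)) =
          fun x => colSum x (c ∘ topEdge : Edge w r₁ → ZMod d) - i then
        ((d : ℂ) ^ ((w + 1) * (r₁ + r₂)))⁻¹ else 0 := by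
  rw [roughInit_tmul_apply, ket_apply 0, ket_apply 0, ite_zero_mul_ite_zero, ← ite_and, ← mul_inv,
    ← pow_add, ← mul_add]
  congr 1
  set c' := c - coboundary k with hc'
  have hflat : IsFlat c' ↔ IsFlat c := by simp [IsFlat, hc', flux_sub, flux_coboundary]
  have hcol : colSum 0 c' = colSum 0 c := by simp [hc', colSum_sub, colSum_coboundary]
  have htop (x : Fin (w + 1)) : colSum x (c' ∘ topEdge : Edge w r₁ → ZMod d) =
      colSum x (c ∘ topEdge : Edge w r₁ → ZMod d) - k (x, roughSeam r₁ r₂) := by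
    rw [← colSum_coboundary_comp_topEdge x k, ← colSum_sub]
    rfl
  refine propext ⟨?_, ?_⟩
  · rintro ⟨h0, ⟨h1, h2⟩, h3, h4⟩
    have h5 : IsFlat c' := (isFlat_comp_topEdge_and_bottomEdge h0).mp ⟨h1, h3⟩
    refine ⟨⟨hflat.mp h5, ?_⟩, ?_⟩
    · rw [← hcol, colSum_eq_bottom_add_top, h2, h4, add_comm]
    · have h6 (x : Fin (w + 1)) : colSum x (c' ∘ topEdge : Edge w r₁ → ZMod d) = i := by
        rw [← h2]
        exact h1.colSum_eq _ _
      ext x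
      rw [← h6 x, htop, sub_sub_cancel]
  · rintro ⟨⟨h1, h2⟩, h3⟩
    have h4 (x : Fin (w + 1)) : colSum x (c' ∘ topEdge : Edge w r₁ → ZMod d) = i := by
      rw [htop, congrFun h3 x, sub_sub_cancel]
    have h0 (x : Fin w) : c' (.inl (x, roughSeam r₁ r₂)) = 0 := by
      rw [(hflat.mpr h1).roughSeam_eq, h4, h4, sub_self]
    obtain ⟨h5, h6⟩ := (isFlat_comp_topEdge_and_bottomEdge h0).mpr (hflat.mpr h1)
    refine ⟨h0, ⟨h5, h4 0⟩, h6, ?_⟩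
    have h7 := colSum_eq_bottom_add_top (0 : Fin (w + 1)) c'
    rw [h4, hcol, h2] at h7
    linear_combination -h7

theorem syndromeProj_roughInit_ket_eq_zero (y₁ : Fin (r₁ + 1)) (y₂ : Fin (r₂ + 1)) (i j : ZMod d)
    {a : Vertex w (r₂ + 1 + r₁) → ZMod d} {b : Face w (r₂ + 1 + r₁) → ZMod d}
    (h : (∃ v, v.2 ≠ roughSeam r₁ r₂ ∧ a v ≠ 0) ∨ b ≠ 0) :
    syndromeProj a b (roughInit d w r₁ r₂ (ket y₁ i ⊗ₜ ket y₂ j)) = 0 := by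
  classical
  have h0 (c : Edge w (r₂ + 1 + r₁) → ZMod d) :=
    roughInit_ket_sub_coboundary y₁ y₂ i j 0 c
  simp only [coboundary_zero, sub_zero] at h0
  rcases h with ⟨v, hv, ha⟩ | h
  · refine syndromeProj_eq_zero_of_vertex b ha fun c => ?_
    rw [roughInit_ket_sub_coboundary, h0]
    have (x : Fin (w + 1)) : Pi.single (M := fun _ => ZMod d) v 1 (x, roughSeam r₁ r₂) = 0 :=
      Pi.single_eq_of_ne (fun h => hv (congrArg Prod.snd h).symm) _
    simp only [this, Pi.zero_apply]
  · obtain ⟨p, hp⟩ := Function.ne_iff.mp h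
    refine syndromeProj_eq_zero_of_face a (p := p) fun c hc => ?_
    rw [h0 c, if_neg fun h => hp (hc ▸ h.1.1 p)]

theorem card_filter_roughSeam_eq (g : Fin (w + 1) → ZMod d) :
    (Finset.univ.filter fun k : Vertex w (r₂ + 1 + r₁) → ZMod d =>
      (fun x => k (x, roughSeam r₁ r₂)) = g).card = d ^ ((w + 1) * (r₁ + r₂)) := by
  have h : (Finset.univ.filter fun k : Vertex w (r₂ + 1 + r₁) → ZMod d =>
      (fun x => k (x, roughSeam r₁ r₂)) = g) =
      Fintype.piFinset fun v : Vertex w (r₂ + 1 + r₁) =>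
        if v.2 = roughSeam r₁ r₂ then {g v.1} else Finset.univ := by
    ext k
    simp only [Finset.mem_filter, Finset.mem_univ, true_and, Fintype.mem_piFinset]
    constructor
    · rintro rfl ⟨x, y⟩
      split_ifs with hy
      · subst hy
        simp
      · simp
    · intro h
      ext x
      simpa using h (x, roughSeam r₁ r₂)
  rw [h, Fintype.card_piFinset]
  have hrow (x : Fin (w + 1)) : ∏ y, (if ((x, y) : Vertex w (r₂ + 1 + r₁)).2 = roughSeam r₁ r₂ then
      ({g x} : Finset (ZMod d)) else Finset.univ).card = d ^ (r₁ + r₂) := by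
    simp only [apply_ite Finset.card, Finset.card_singleton, Finset.card_univ, ZMod.card]
    rw [Finset.prod_ite, Finset.prod_const_one, one_mul, Finset.prod_const, Finset.filter_ne',
      Finset.card_erase_of_mem (Finset.mem_univ _), Finset.card_univ, Fintype.card_fin]
    congr 1
    omega
  rw [Fintype.prod_prod_type, Finset.prod_congr rfl fun x _ => hrow x, Finset.prod_const,
    Finset.card_univ, Fintype.card_fin, ← pow_mul, mul_comm]

theorem pairing_roughSyndrome (s : Fin (w + 1) → ZMod d) (k : Vertex w (r₂ + 1 + r₁) → ZMod d) :
    pairing (roughSyndrome s) k = pairing s fun x => k (x, roughSeam r₁ r₂) := by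
  simp [pairing, roughSyndrome, Fintype.sum_prod_type]

open Classical in
theorem syndromeProj_roughSyndrome_ket_apply (s : Fin (w + 1) → ZMod d) (y₁ : Fin (r₁ + 1))
    (y₂ : Fin (r₂ + 1)) (i j : ZMod d) (c : Edge w (r₂ + 1 + r₁) → ZMod d) :
    syndromeProj (roughSyndrome s) 0 (roughInit d w r₁ r₂ (ket y₁ i ⊗ₜ ket y₂ j)) c =
      if IsFlat c ∧ colSum 0 c = i + j then ((d : ℂ) ^ ((w + 1) * (r₂ + 1 + r₁)))⁻¹ *
        pairing s fun x => colSum x (c ∘ topEdge : Edge w r₁ → ZMod d) - i else 0 := by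
  rw [syndromeProj_apply]
  simp only [Pi.zero_apply, roughInit_ket_sub_coboundary, pairing_roughSyndrome]
  by_cases hc : IsFlat c ∧ colSum 0 c = i + j
  · rw [if_pos hc, if_pos (show ∀ p, flux p c = 0 from hc.1)]
    congr 1
    simp only [hc, and_self, true_and]
    set g : Fin (w + 1) → ZMod d := fun x => colSum x (c ∘ topEdge : Edge w r₁ → ZMod d) - i
    have h (k : Vertex w (r₂ + 1 + r₁) → ZMod d) :
        (pairing s (fun x => k (x, roughSeam r₁ r₂)) *
          if (fun x => k (x, roughSeam r₁ r₂)) = g then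
            ((d : ℂ) ^ ((w + 1) * (r₁ + r₂)))⁻¹ else 0) =
        if (fun x => k (x, roughSeam r₁ r₂)) = g then
          pairing s g * ((d : ℂ) ^ ((w + 1) * (r₁ + r₂)))⁻¹ else 0 := by
      split_ifs with hk
      · rw [hk]
      · rw [mul_zero]
    simp_rw [h]
    rw [← Finset.sum_filter, Finset.sum_const]
    have hcard := card_filter_roughSeam_eq (r₁ := r₁) (r₂ := r₂) g
    rw [show (Finset.univ.filter fun k : Vertex w (r₂ + 1 + r₁) → ZMod d =>
      (fun x => k (x, roughSeam r₁ r₂)) = g).card = d ^ ((w + 1) * (r₁ + r₂)) by convert hcard,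
      nsmul_eq_mul]
    push_cast
    rw [mul_left_comm, mul_inv_cancel₀ (pow_ne_zero _ natCast_ne_zero), mul_one]
  · rw [if_neg hc]
    simp [hc]

theorem sum_vertexWeight_mul_elim {r : ℕ} (v : Vertex w r)
    (f : Fin (w + 1) × Fin (r + 1) → ZMod d) :
    ∑ e : Edge w r, vertexWeight d v e * Sum.elim (fun _ => 0) f e =
      f (v.1, v.2.succ) - f (v.1, v.2.castSucc) := by
  obtain ⟨x, y⟩ := v
  have h1 : ∀ (a : Fin (w + 1)) (b : Fin (r + 1)),
      (tail (.inr (a, b) : Edge w r) = vertexPos (x, y)) ↔ x = a ∧ y.succ = b := by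
    intro a b
    simp only [tail, vertexPos, Fin.ext_iff, Prod.mk.injEq, Fin.val_succ]
    omega
  have h2 : ∀ (a : Fin (w + 1)) (b : Fin (r + 1)),
      (head (.inr (a, b) : Edge w r) = vertexPos (x, y)) ↔ x = a ∧ y.castSucc = b := by
    intro a b
    simp only [head, vertexPos, Fin.ext_iff, Prod.mk.injEq, Fin.val_castSucc]
    omega
  simp [vertexWeight, h1, h2, sub_mul, Fintype.sum_prod_type, ite_and, Finset.sum_ite_irrel]

theorem exists_isRoughCorrection (s : Fin (w + 1) → ZMod d) :
    ∃ t : Edge w (r₂ + 1 + r₁) → ZMod d, IsRoughCorrection s t := by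
  -- For each new vertex with outcome `s x`, a string from the seam to the top.
  refine ⟨Sum.elim (fun _ => 0) fun e => if r₂ < (e.2 : ℕ) then -s e.1 else 0, ?_, fun v => ?_⟩
  · rintro (e | ⟨x, y⟩)
    · rfl
    · simp only [bottomEdge, Sum.elim_inr, Fin.val_castAdd]
      exact if_neg (by omega)
  · rw [sum_vertexWeight_mul_elim]
    simp only [roughSyndrome, roughSeam, Fin.ext_iff, Fin.val_castSucc, Fin.val_succ,
      Fin.val_castAdd, Fin.val_last]
    split_ifs <;> first | omega | simp

/-- A correction acts on flat labellings through their sums above the new vertices: up to a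
coboundary, a flat labelling is a string operator along the lower boundary, where the correction is
trivial. -/
theorem IsRoughCorrection.sum_mul {s : Fin (w + 1) → ZMod d}
    {t : Edge w (r₂ + 1 + r₁) → ZMod d} (ht : IsRoughCorrection s t)
    {c : Edge w (r₂ + 1 + r₁) → ZMod d} (hc : IsFlat c) :
    ∑ e, t e * c e = -∑ x, s x * colSum x (c ∘ topEdge : Edge w r₁ → ZMod d) := by
  obtain ⟨k, hk⟩ := (exists_coboundary_iff (c - rowString 0 (colSum 0 c)) (0 : Fin (w + 1))).mpr
    ⟨fun p => by rw [flux_sub, hc p, flux_rowString, sub_zero],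
      by rw [colSum_sub, colSum_rowString, sub_self]⟩
  have htop (x : Fin (w + 1)) :
      k (x, roughSeam r₁ r₂) = colSum x (c ∘ topEdge : Edge w r₁ → ZMod d) := by
    rw [← colSum_coboundary_comp_topEdge x k, hk]
    refine Finset.sum_congr rfl fun y _ => ?_
    have : (Fin.natAdd (r₂ + 1) y : Fin (r₂ + 1 + (r₁ + 1))) ≠ 0 :=
      Fin.ne_of_val_ne (show r₂ + 1 + (y : ℕ) ≠ 0 by omega)
    simp only [Function.comp_apply, topEdge, Pi.sub_apply, rowString]
    rw [if_neg this, sub_zero]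
  have hstring (e) : t e * rowString 0 (colSum 0 c) e = 0 := by
    rcases e with e | ⟨x, y⟩
    · simp [rowString]
    · by_cases hy : y = 0
      · have : t (.inr (x, y)) = 0 := by
          rw [hy]
          exact ht.1 (.inr (x, 0))
        rw [this, zero_mul]
      · simp [rowString, hy]
  have h1 : ∑ e, t e * c e = ∑ e, t e * coboundary k e := by
    refine Finset.sum_congr rfl fun e _ => ?_
    rw [hk, Pi.sub_apply, mul_sub, hstring, sub_zero]
  have h2 : ∑ e, t e * coboundary k e = ∑ v, k v * ∑ e, vertexWeight d v e * t e := by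
    simp only [coboundary, Finset.mul_sum]
    rw [Finset.sum_comm]
    exact Finset.sum_congr rfl fun v _ => Finset.sum_congr rfl fun e _ => by ring
  rw [h1, h2]
  simp_rw [ht.2]
  simp only [roughSyndrome, mul_neg, Finset.sum_neg_distrib, Fintype.sum_prod_type, mul_ite,
    mul_zero, Finset.sum_ite_eq', Finset.mem_univ, if_true, htop]
  simp only [mul_comm]

theorem roughKraus_ket {s : Fin (w + 1) → ZMod d} {t : Edge w (r₂ + 1 + r₁) → ZMod d}
    (ht : IsRoughCorrection s t) {n : ZMod d} (hn : n = -∑ k, s k) (y₁ : Fin (r₁ + 1))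
    (y₂ : Fin (r₂ + 1)) (y : Fin (r₂ + 1 + r₁ + 1)) (i j : ZMod d) :
    roughKraus s t (ket y₁ i ⊗ₜ[ℂ] ket y₂ j) = qpow d i n • ket y (i + j) := by
  classical
  ext c
  rw [roughKraus, LinearMap.comp_apply, LinearMap.comp_apply, zOp_apply,
    syndromeProj_roughSyndrome_ket_apply, PiLp.smul_apply, ket_apply 0, smul_eq_mul]
  split_ifs with hc
  · rw [mul_left_comm, mul_comm]
    congr 1
    rw [pairing, pairing, ht.sum_mul hc.1, ← qpow_add_right, hn]
    simp only [qpow, mul_sub, Finset.sum_sub_distrib, ← Finset.sum_mul]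
    congr 1
    ring
  · simp

theorem roughKraus_deltaKet {s : Fin (w + 1) → ZMod d} {t : Edge w (r₂ + 1 + r₁) → ZMod d}
    (ht : IsRoughCorrection s t) {n : ZMod d} (hn : n = -∑ k, s k) (x₁ x₂ x : Fin (w + 1))
    (y₁ : Fin (r₁ + 1)) (y₂ : Fin (r₂ + 1)) (y : Fin (r₂ + 1 + r₁ + 1)) (i j : ZMod d) :
    roughKraus s t (deltaKet x₁ y₁ i ⊗ₜ[ℂ] deltaKet x₂ y₂ j) =
      if i = j + n then (d : ℂ) • deltaKet x y j else 0 := by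
  simp only [deltaKet_eq, TensorProduct.sum_tmul, TensorProduct.tmul_sum,
    TensorProduct.smul_tmul_smul, map_sum, map_smul, roughKraus_ket ht hn y₁ y₂ y, smul_smul]
  have h : ∑ k, ∑ l, (qpow d (-i) k * qpow d (-j) l * qpow d k n) •
      (ket y (k + l) : Hilb d w (r₂ + 1 + r₁)) =
      ∑ k, ∑ m, qpow d k (-i + j + n) • qpow d (-j) m • ket y m := by
    refine Finset.sum_congr rfl fun k _ => ?_
    rw [← Equiv.sum_comp (Equiv.addLeft k)
      fun m => qpow d k (-i + j + n) • qpow d (-j) m • (ket y m : Hilb d w (r₂ + 1 + r₁))]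
    refine Finset.sum_congr rfl fun l _ => ?_
    rw [Equiv.coe_addLeft, smul_smul]
    congr 1
    simp only [qpow, ← AddChar.map_add_eq_mul]
    congr 1
    ring
  rw [Finset.sum_comm, h]
  simp_rw [← Finset.smul_sum]
  rw [← Finset.sum_smul, sum_qpow]
  have : -i + j + n = 0 ↔ i = j + n := by rw [add_assoc, neg_add_eq_zero]
  simp only [this]
  split_ifs <;> simp

theorem xString_deltaKet {r : ℕ} (x : Fin (w + 1)) (y y' : Fin (r + 1)) (i k : ZMod d) :
    xString y i (deltaKet x y' k : Hilb d w r) = qpow d k i • deltaKet x y' k := by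
  simp only [deltaKet_eq, map_sum, map_smul, xString_ket, Finset.smul_sum, smul_smul]
  rw [← Equiv.sum_comp (Equiv.addRight i)
    fun l => (qpow d k i * qpow d (-k) l) • (ket y' l : Hilb d w r)]
  refine Finset.sum_congr rfl fun l _ => ?_
  rw [Equiv.coe_addRight]
  congr 1
  simp only [qpow, ← AddChar.map_add_eq_mul]
  congr 1
  ring

theorem syndromeProj_roughSyndrome_deltaKet_eq_zero (x₁ x₂ : Fin (w + 1)) (y₁ : Fin (r₁ + 1))
    (y₂ : Fin (r₂ + 1)) {i j : ZMod d} {s : Fin (w + 1) → ZMod d} (h : i - j ≠ -∑ k, s k) :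
    syndromeProj (roughSyndrome s) 0
      (roughInit d w r₁ r₂ (deltaKet x₁ y₁ i ⊗ₜ deltaKet x₂ y₂ j)) = 0 := by
  obtain ⟨t, ht⟩ := exists_isRoughCorrection (r₁ := r₁) (r₂ := r₂) s
  have h1 := roughKraus_deltaKet ht rfl x₁ x₂ 0 y₁ y₂ 0 i j
  rw [if_neg fun h' => h (by rw [h', add_sub_cancel_left])] at h1
  ext c
  have h2 := congrArg (fun φ : Hilb d w (r₂ + 1 + r₁) => φ c) h1
  simp only [roughKraus, LinearMap.comp_apply, zOp_apply] at h2
  exact (mul_eq_zero.mp h2).resolve_left (left_ne_zero_of_mul_eq_one (pairing_mul_neg t c))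

theorem roughEdges_bijective : Function.Bijective
    (Sum.elim topEdge (Sum.elim bottomEdge fun x : Fin w => .inl (x, roughSeam r₁ r₂)) :
      Edge w r₁ ⊕ Edge w r₂ ⊕ Fin w → Edge w (r₂ + 1 + r₁)) := by
  constructor
  · rintro ((⟨x, y⟩ | ⟨x, y⟩) | (⟨x, y⟩ | ⟨x, y⟩) | x)
      ((⟨x', y'⟩ | ⟨x', y'⟩) | (⟨x', y'⟩ | ⟨x', y'⟩) | x') h <;>
    simp [topEdge, bottomEdge, roughSeam, Fin.ext_iff] at h ⊢ <;> omega
  · rintro (⟨x, y⟩ | ⟨x, y⟩)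
    · induction y using Fin.addCases with
      | left y =>
        induction y using Fin.lastCases with
        | last => exact ⟨.inr (.inr x), rfl⟩
        | cast y => exact ⟨.inr (.inl (.inl (x, y))), rfl⟩
      | right y => exact ⟨.inl (.inl (x, y)), rfl⟩
    · induction y using Fin.addCases (m := r₂ + 1) (n := r₁ + 1) with
      | left y => exact ⟨.inr (.inl (.inr (x, y))), rfl⟩
      | right y => exact ⟨.inl (.inr (x, y)), rfl⟩

theorem norm_roughInit_sq (Ψ : Hilb d w r₁ ⊗[ℂ] Hilb d w r₂) :
    ‖roughInit d w r₁ r₂ Ψ‖ ^ 2 = 1 * ‖Ψ‖ ^ 2 := by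
  refine norm_sq_of_inner_tmul (fun a b a' b' => ?_) Ψ
  rw [PiLp.inner_apply, PiLp.inner_apply, PiLp.inner_apply]
  have h := sum_comp_mul_comp (roughEdges_bijective (w := w) (r₁ := r₁) (r₂ := r₂))
    (fun c : Edge w r₁ → ZMod d => inner ℂ (a c) (a' c)) (fun c => inner ℂ (b c) (b' c))
    (fun c => if c = 0 then 1 else 0)
  rw [Finset.sum_ite_eq' Finset.univ 0, if_pos (Finset.mem_univ _), mul_one] at h
  rw [Complex.ofReal_one, one_mul, ← h]
  refine Finset.sum_congr rfl fun c _ => ?_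
  simp only [roughInit_tmul_apply, RCLike.inner_apply, funext_iff, Function.comp_apply,
    Pi.zero_apply]
  split_ifs
  · rw [map_mul]
    ring
  · simp

end Rough

/-! ### Outcomes of the two merges -/

theorem syndromeProj_smoothInit_eq_zero {w₁ w₂ r : ℕ} {Ψ : Hilb d w₁ r ⊗[ℂ] Hilb d w₂ r}
    (hΨ : Ψ ∈ pairVac d w₁ r w₂ r) {a : Vertex (w₁ + 1 + w₂) r → ZMod d}
    {b : Face (w₁ + 1 + w₂) r → ZMod d} (h : a ≠ 0 ∨ ∃ p, p.1 ≠ smoothSeam w₁ w₂ ∧ b p ≠ 0) :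
    syndromeProj a b (smoothInit d w₁ w₂ r Ψ) = 0 := by
  rw [pairVac_eq_span (span_ket 0) (span_ket 0)] at hΨ
  refine LinearMap.eqOn_span (f := syndromeProj a b ∘ₗ smoothInit d w₁ w₂ r) (g := 0) ?_ hΨ
  rintro _ ⟨i, rfl⟩
  exact syndromeProj_smoothInit_ket_eq_zero 0 0 _ _ h

theorem smooth_measurement {w₁ w₂ r : ℕ} (x₁ : Fin (w₁ + 1)) (x₂ : Fin (w₂ + 1))
    {Ψ : Hilb d w₁ r ⊗[ℂ] Hilb d w₂ r} (hΨ : Ψ ∈ pairVac d w₁ r w₂ r) :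
    (∀ s : Fin (r + 1) → ZMod d, syndromeProj 0 (smoothSyndrome s) (smoothInit d w₁ w₂ r Ψ) =
        syndromeProj 0 (smoothSyndrome s) (smoothInit d w₁ w₂ r
          (outcomeProj (TensorProduct.map (zString x₁ (1 : ZMod d)) (zString x₂ (-1)))
            (-∑ k, s k) Ψ))) ∧
      ∀ n : ZMod d, ∑ s : Fin (r + 1) → ZMod d with -∑ k, s k = n,
          prob (syndromeProj 0 (smoothSyndrome s)) (smoothInit d w₁ w₂ r Ψ) =
        prob (outcomeProj (TensorProduct.map (zString x₁ (1 : ZMod d)) (zString x₂ (-1))) n)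
          Ψ := by
  rw [pairVac_eq_span (span_ket 0) (span_ket 0)] at hΨ
  refine measurement_realises (S := fun s => syndromeProj 0 (smoothSyndrome s))
    (f := fun s => -∑ k, s k) (ev := fun i : ZMod d × ZMod d => i.2 - i.1)
    (inner_map_of_inner (inner_zString (d := d) (r := r) x₁ 1)
      (inner_zString (d := d) (r := r) x₂ (-1)))
    (pow_pos (Nat.cast_pos.mpr (NeZero.pos d)) r) norm_smoothInit_sq
    (fun s => inner_syndromeProj_self _ _) (fun i => ?_)
    (fun s i h => syndromeProj_smoothSyndrome_ket_eq_zero 0 0 h) (fun i => ?_) hΨ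
  · rw [TensorProduct.map_tmul, zString_ket, zString_ket, TensorProduct.smul_tmul_smul]
    congr 1
    simp only [qpow, ← AddChar.map_add_eq_mul]
    congr 1
    ring
  · refine sum_syndromeProj_of_injective (g := fun s => (0, smoothSyndrome s)) ?_ ?_
    · intro s s' h
      ext k
      simpa [smoothSyndrome] using congrFun (congrArg Prod.snd h) (smoothSeam w₁ w₂, k)
    · rintro ⟨a, b⟩ hab
      refine syndromeProj_smoothInit_ket_eq_zero 0 0 _ _ ?_
      by_contra! hcon
      refine hab ⟨fun k => b (smoothSeam w₁ w₂, k), Prod.ext hcon.1.symm ?_⟩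
      ext ⟨x, y⟩
      by_cases hx : x = smoothSeam w₁ w₂
      · simp [smoothSyndrome, hx]
      · simpa [smoothSyndrome, hx] using (hcon.2 (x, y) hx).symm

theorem syndromeProj_roughInit_eq_zero {w r₁ r₂ : ℕ} {Ψ : Hilb d w r₁ ⊗[ℂ] Hilb d w r₂}
    (hΨ : Ψ ∈ pairVac d w r₁ w r₂) {a : Vertex w (r₂ + 1 + r₁) → ZMod d}
    {b : Face w (r₂ + 1 + r₁) → ZMod d} (h : (∃ v, v.2 ≠ roughSeam r₁ r₂ ∧ a v ≠ 0) ∨ b ≠ 0) :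
    syndromeProj a b (roughInit d w r₁ r₂ Ψ) = 0 := by
  rw [pairVac_eq_span (span_ket 0) (span_ket 0)] at hΨ
  refine LinearMap.eqOn_span (f := syndromeProj a b ∘ₗ roughInit d w r₁ r₂) (g := 0) ?_ hΨ
  rintro _ ⟨i, rfl⟩
  exact syndromeProj_roughInit_ket_eq_zero 0 0 _ _ h

theorem rough_measurement {w r₁ r₂ : ℕ} (y₁ : Fin (r₁ + 1)) (y₂ : Fin (r₂ + 1))
    {Ψ : Hilb d w r₁ ⊗[ℂ] Hilb d w r₂} (hΨ : Ψ ∈ pairVac d w r₁ w r₂) :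
    (∀ s : Fin (w + 1) → ZMod d, syndromeProj (roughSyndrome s) 0 (roughInit d w r₁ r₂ Ψ) =
        syndromeProj (roughSyndrome s) 0 (roughInit d w r₁ r₂
          (outcomeProj (TensorProduct.map (xString y₁ (1 : ZMod d)) (xString y₂ (-1)))
            (-∑ k, s k) Ψ))) ∧
      ∀ n : ZMod d, ∑ s : Fin (w + 1) → ZMod d with -∑ k, s k = n,
          prob (syndromeProj (roughSyndrome s) 0) (roughInit d w r₁ r₂ Ψ) =
        prob (outcomeProj (TensorProduct.map (xString y₁ (1 : ZMod d)) (xString y₂ (-1))) n)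
          Ψ := by
  rw [pairVac_eq_span (span_deltaKet 0 0) (span_deltaKet 0 0)] at hΨ
  refine measurement_realises (S := fun s => syndromeProj (roughSyndrome s) 0)
    (f := fun s => -∑ k, s k) (ev := fun i : ZMod d × ZMod d => i.1 - i.2)
    (inner_map_of_inner (inner_xString (d := d) (w := w) y₁ 1)
      (inner_xString (d := d) (w := w) y₂ (-1)))
    one_pos norm_roughInit_sq
    (fun s => inner_syndromeProj_self _ _) (fun i => ?_)
    (fun s i h => syndromeProj_roughSyndrome_deltaKet_eq_zero 0 0 0 0 h) (fun i => ?_) hΨ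
  · rw [TensorProduct.map_tmul, xString_deltaKet, xString_deltaKet, TensorProduct.smul_tmul_smul]
    congr 1
    simp only [qpow, ← AddChar.map_add_eq_mul]
    congr 1
    ring
  · refine sum_syndromeProj_of_injective (g := fun s => (roughSyndrome s, 0)) ?_ ?_
    · intro s s' h
      ext k
      simpa [roughSyndrome] using congrFun (congrArg Prod.fst h) (k, roughSeam r₁ r₂)
    · rintro ⟨a, b⟩ hab
      have hmem : deltaKet 0 0 i.1 ⊗ₜ[ℂ] deltaKet 0 0 i.2 ∈ pairVac d w r₁ w r₂ := by
        rw [pairVac_eq_span (span_deltaKet 0 0) (span_deltaKet 0 0)]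
        exact Submodule.subset_span ⟨i, rfl⟩
      refine syndromeProj_roughInit_eq_zero hmem ?_
      by_contra! hcon
      refine hab ⟨fun k => a (k, roughSeam r₁ r₂), Prod.ext ?_ hcon.2.symm⟩
      ext ⟨x, y⟩
      by_cases hy : y = roughSeam r₁ r₂
      · simp [roughSyndrome, hy]
      · simpa [roughSyndrome, hy] using (hcon.1 (x, y) hy).symm

theorem smoothKraus_mem_vac {w₁ w₂ r : ℕ} {s : Fin (r + 1) → ZMod d}
    {t : Edge (w₁ + 1 + w₂) r → ZMod d} (ht : IsSmoothCorrection s t)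
    {Ψ : Hilb d w₁ r ⊗[ℂ] Hilb d w₂ r} (hΨ : Ψ ∈ pairVac d w₁ r w₂ r) :
    smoothKraus s t Ψ ∈ vac d (w₁ + 1 + w₂) r := by
  rw [pairVac_eq_span (span_ket 0) (span_ket 0)] at hΨ
  refine (Submodule.span_le (p := (vac d (w₁ + 1 + w₂) r).comap (smoothKraus s t))).mpr ?_ hΨ
  rintro _ ⟨i, rfl⟩
  change smoothKraus s t (ket 0 i.1 ⊗ₜ ket 0 i.2) ∈ vac d (w₁ + 1 + w₂) r
  rw [smoothKraus_ket ht rfl 0 0 0]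
  split_ifs
  · exact ket_mem_vac _ _
  · exact Submodule.zero_mem _

theorem roughKraus_mem_vac {w r₁ r₂ : ℕ} {s : Fin (w + 1) → ZMod d}
    {t : Edge w (r₂ + 1 + r₁) → ZMod d} (ht : IsRoughCorrection s t)
    {Ψ : Hilb d w r₁ ⊗[ℂ] Hilb d w r₂} (hΨ : Ψ ∈ pairVac d w r₁ w r₂) :
    roughKraus s t Ψ ∈ vac d w (r₂ + 1 + r₁) := by
  rw [pairVac_eq_span (span_ket 0) (span_ket 0)] at hΨ
  refine (Submodule.span_le (p := (vac d w (r₂ + 1 + r₁)).comap (roughKraus s t))).mpr ?_ hΨ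
  rintro _ ⟨i, rfl⟩
  change roughKraus s t (ket 0 i.1 ⊗ₜ ket 0 i.2) ∈ vac d w (r₂ + 1 + r₁)
  rw [roughKraus_ket ht rfl 0 0 0]
  exact Submodule.smul_mem _ _ (ket_mem_vac _ _)

end

end LatticeSurgery

theorem mainTheorem2 (d : ℕ) [NeZero d] (hd : 2 ≤ d) :
    -- the two canonical bases of the logical space of a patch
    (∀ (w r : ℕ) (x : Fin (w + 1)) (y : Fin (r + 1)),
      (LinearIndependent ℂ (fun i : ZMod d => (ket y i : Hilb d w r)) ∧
        Submodule.span ℂ (Set.range fun i : ZMod d => (ket y i : Hilb d w r)) = vac d w r) ∧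
      (LinearIndependent ℂ (fun i : ZMod d => (deltaKet x y i : Hilb d w r)) ∧
        Submodule.span ℂ (Set.range fun i : ZMod d => (deltaKet x y i : Hilb d w r)) =
          vac d w r)) ∧
    -- smooth merges
    (∀ (w₁ w₂ r : ℕ) (x₁ : Fin (w₁ + 1)) (x₂ : Fin (w₂ + 1)) (x : Fin (w₁ + 1 + w₂ + 1))
        (y₁ y₂ y : Fin (r + 1)),
      -- only the new faces can have nontrivial outcomes
      (∀ Ψ ∈ pairVac d w₁ r w₂ r, ∀ (a : Vertex (w₁ + 1 + w₂) r → ZMod d)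
          (b : Face (w₁ + 1 + w₂) r → ZMod d),
        (a ≠ 0 ∨ ∃ p, p.1 ≠ smoothSeam w₁ w₂ ∧ b p ≠ 0) →
          syndromeProj a b (smoothInit d w₁ w₂ r Ψ) = 0) ∧
      -- their outcomes realise a measurement of `Z_L ⊗ Z_L†`: states after the measurement
      (∀ Ψ ∈ pairVac d w₁ r w₂ r, ∀ s : Fin (r + 1) → ZMod d,
        syndromeProj 0 (smoothSyndrome s) (smoothInit d w₁ w₂ r Ψ) =
          syndromeProj 0 (smoothSyndrome s) (smoothInit d w₁ w₂ r
            (outcomeProj (TensorProduct.map (zString x₁ (1 : ZMod d)) (zString x₂ (-1)))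
              (-∑ k, s k) Ψ))) ∧
      -- and probabilities
      (∀ Ψ ∈ pairVac d w₁ r w₂ r, ∀ n : ZMod d,
        ∑ s : Fin (r + 1) → ZMod d with -∑ k, s k = n,
            prob (syndromeProj 0 (smoothSyndrome s)) (smoothInit d w₁ w₂ r Ψ) =
          prob (outcomeProj (TensorProduct.map (zString x₁ (1 : ZMod d)) (zString x₂ (-1))) n)
            Ψ) ∧
      -- the Kraus operators
      (∀ s : Fin (r + 1) → ZMod d,
        (∃ t : Edge (w₁ + 1 + w₂) r → ZMod d, IsSmoothCorrection s t) ∧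
        ∀ t : Edge (w₁ + 1 + w₂) r → ZMod d, IsSmoothCorrection s t →
          (∀ Ψ ∈ pairVac d w₁ r w₂ r, smoothKraus s t Ψ ∈ vac d (w₁ + 1 + w₂) r) ∧
          ∀ n : ZMod d, n = -∑ k, s k →
            (∀ i j : ZMod d,
              smoothKraus s t (deltaKet x₁ y₁ i ⊗ₜ[ℂ] deltaKet x₂ y₂ j) =
                qpow d i n • deltaKet x y (i + j)) ∧
            (∀ i j : ZMod d,
              smoothKraus s t (ket y₁ i ⊗ₜ[ℂ] ket y₂ j) =
                if i + n = j then ket y (i + n) else 0) ∧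
            -- for `n = 0`, multiplication of `ℂ ℤ_d` and of `ℂ(ℤ_d)`
            (n = 0 →
              (∀ a b : AddMonoidAlgebra ℂ (ZMod d),
                smoothKraus s t
                    (groupEncode (deltaKet x₁ y₁) a ⊗ₜ[ℂ] groupEncode (deltaKet x₂ y₂) b) =
                  groupEncode (deltaKet x y) (a * b)) ∧
              ∀ f g : ZMod d → ℂ,
                smoothKraus s t (functionEncode (ket y₁) f ⊗ₜ[ℂ] functionEncode (ket y₂) g) =
                  functionEncode (ket y) (f * g)))) ∧
    -- rough merges
    (∀ (w r₁ r₂ : ℕ) (x₁ x₂ x : Fin (w + 1)) (y₁ : Fin (r₁ + 1)) (y₂ : Fin (r₂ + 1))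
        (y : Fin (r₂ + 1 + r₁ + 1)),
      -- only the new vertices can have nontrivial outcomes
      (∀ Ψ ∈ pairVac d w r₁ w r₂, ∀ (a : Vertex w (r₂ + 1 + r₁) → ZMod d)
          (b : Face w (r₂ + 1 + r₁) → ZMod d),
        ((∃ v, v.2 ≠ roughSeam r₁ r₂ ∧ a v ≠ 0) ∨ b ≠ 0) →
          syndromeProj a b (roughInit d w r₁ r₂ Ψ) = 0) ∧
      -- their outcomes realise a measurement of `X_L ⊗ X_L†`: states after the measurement
      (∀ Ψ ∈ pairVac d w r₁ w r₂, ∀ s : Fin (w + 1) → ZMod d,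
        syndromeProj (roughSyndrome s) 0 (roughInit d w r₁ r₂ Ψ) =
          syndromeProj (roughSyndrome s) 0 (roughInit d w r₁ r₂
            (outcomeProj (TensorProduct.map (xString y₁ (1 : ZMod d)) (xString y₂ (-1)))
              (-∑ k, s k) Ψ))) ∧
      -- and probabilities
      (∀ Ψ ∈ pairVac d w r₁ w r₂, ∀ n : ZMod d,
        ∑ s : Fin (w + 1) → ZMod d with -∑ k, s k = n,
            prob (syndromeProj (roughSyndrome s) 0) (roughInit d w r₁ r₂ Ψ) =
          prob (outcomeProj (TensorProduct.map (xString y₁ (1 : ZMod d)) (xString y₂ (-1))) n)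
            Ψ) ∧
      -- the Kraus operators
      (∀ s : Fin (w + 1) → ZMod d,
        (∃ t : Edge w (r₂ + 1 + r₁) → ZMod d, IsRoughCorrection s t) ∧
        ∀ t : Edge w (r₂ + 1 + r₁) → ZMod d, IsRoughCorrection s t →
          (∀ Ψ ∈ pairVac d w r₁ w r₂, roughKraus s t Ψ ∈ vac d w (r₂ + 1 + r₁)) ∧
          ∀ n : ZMod d, n = -∑ k, s k →
            (∀ i j : ZMod d,
              roughKraus s t (ket y₁ i ⊗ₜ[ℂ] ket y₂ j) = qpow d i n • ket y (i + j)) ∧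
            -- for `n = 0`, multiplication of `ℂ ℤ_d` and of `ℂ(ℤ_d)`
            (n = 0 →
              (∀ a b : AddMonoidAlgebra ℂ (ZMod d),
                roughKraus s t (groupEncode (ket y₁) a ⊗ₜ[ℂ] groupEncode (ket y₂) b) =
                  groupEncode (ket y) (a * b)) ∧
              ∀ f g : ZMod d → ℂ,
                roughKraus s t
                    (functionEncode (fun i => (1 / (d : ℂ)) • deltaKet x₁ y₁ i) f ⊗ₜ[ℂ]
                      functionEncode (fun i => (1 / (d : ℂ)) • deltaKet x₂ y₂ i) g) =
                  functionEncode (fun i => (1 / (d : ℂ)) • deltaKet x y i) (f * g)))) := by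
  refine ⟨fun w r x y => ⟨⟨ket_linearIndependent y, span_ket y⟩,
      deltaKet_linearIndependent x y, span_deltaKet x y⟩, ?_, ?_⟩
  · intro w₁ w₂ r x₁ x₂ x y₁ y₂ y
    refine ⟨fun Ψ hΨ a b h => syndromeProj_smoothInit_eq_zero hΨ h,
      fun Ψ hΨ => (smooth_measurement x₁ x₂ hΨ).1, fun Ψ hΨ => (smooth_measurement x₁ x₂ hΨ).2,
      fun s => ⟨exists_isSmoothCorrection s, fun t ht => ⟨fun Ψ => smoothKraus_mem_vac ht,
        fun n hn => ⟨smoothKraus_deltaKet ht hn x₁ x₂ x y₁ y₂ y, smoothKraus_ket ht hn y₁ y₂ y,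
          ?_⟩⟩⟩⟩
    rintro rfl
    refine ⟨map_groupEncode_tmul fun i j => ?_, map_functionEncode_tmul fun i j => ?_⟩
    · rw [smoothKraus_deltaKet ht hn x₁ x₂ x y₁ y₂ y, qpow_zero_right, one_smul]
    · rw [smoothKraus_ket ht hn y₁ y₂ y, add_zero]
  · intro w r₁ r₂ x₁ x₂ x y₁ y₂ y
    refine ⟨fun Ψ hΨ a b h => syndromeProj_roughInit_eq_zero hΨ h,
      fun Ψ hΨ => (rough_measurement y₁ y₂ hΨ).1, fun Ψ hΨ => (rough_measurement y₁ y₂ hΨ).2,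
      fun s => ⟨exists_isRoughCorrection s, fun t ht => ⟨fun Ψ => roughKraus_mem_vac ht,
        fun n hn => ⟨roughKraus_ket ht hn y₁ y₂ y, ?_⟩⟩⟩⟩
    rintro rfl
    refine ⟨map_groupEncode_tmul fun i j => ?_, map_functionEncode_tmul fun i j => ?_⟩
    · rw [roughKraus_ket ht hn y₁ y₂ y, qpow_zero_right, one_smul]
    · rw [TensorProduct.smul_tmul_smul, map_smul,
        roughKraus_deltaKet ht hn x₁ x₂ x y₁ y₂ y, add_zero]
      split_ifs with h
      · rw [h, smul_smul]
        congr 1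
        rw [mul_assoc, one_div, inv_mul_cancel₀ natCast_ne_zero, mul_one]
      · rw [smul_zero]
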